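/- Lemma 4.6 (lem:lattice_3pi). Consider the continuum approximation of the discrete $0$-$\pi$ sine-Gordon equation with lattice spacing $a\ge 0$ and zero bias current $\gamma=0$, $$\phi_{xx}=\phi_{tt}+\sin(\phi+\theta)-\tfrac{a^2}{12}\Big(2\phi_{xxtt}+2\phi_{xx}\cos(\phi+\theta)-\phi_x^2\sin(\phi+\theta)-\phi_{tttt}-\phi_{tt}\cos(\phi+\theta)+\phi_t^2\sin(\phi+\theta)-\cos(\phi+\theta)\big(\phi_{tt}+\sin(\phi+\theta)\big)\Big),\quad x\ne0,$$ where $\theta(x)=0$ for $x<0$ and $\theta(x)=-\pi$ for $x>0$. A $3\pi$-kink is a static, continuously differentiable solution $\phi$ with $\phi_x\in H^1(\mathbb R)$, $\phi\to0$ as $x\to-\infty$ and $\phi\to3\pi$ as $x\to+\infty$. An eigenvalue of the linearization about $\phi$ is a number $\Lambda=\lambda^2$, $\lambda\in\mathbb C$, such that the equation linearized about $\phi$ has a solution $e^{\lambda t}v(x)$ with $0\ne v\in H^2(\mathbb R)$. There are $a_0>0$, $C\in\mathbb R$ and a function $\Lambda:\mathbb R\to\mathbb R$ such that for every $0\le a<a_0$: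 a $3\pi$-kink exists; for each $3\pi$-kink all eigenvalues of the linearization are real and $\Lambda(a)$ is the largest one; $\Lambda(a)>0$; and $$\Big|\Lambda(a)-\Big(\frac{\sqrt5-1}{4}+\Lambda_1a^2\Big)\Big|\le C a^4,\qquad \Lambda_1=\frac{7}{48\sqrt5}\approx0.0652 .$$ Moreover $\Lambda$ is strictly increasing on $[0,a_0)$. -/

import Mathlib

open Set Filter Topology MeasureTheory

noncomputable section

namespace LatticeKink

/-- The phase shift `θ(x)` of the 0-π junction: `0` for `x < 0` and `-π` for `x > 0`
(the value at `x = 0` is never used). -/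
def theta (x : ℝ) : ℝ := if 0 < x then -Real.pi else 0

/-- Left minus right side of the continuum model of the discrete 0-π sine-Gordon equation with
lattice spacing `a` and zero bias current,
`φ_xx = φ_tt + sin(φ+θ) - a²/12 (2 φ_xxtt + 2 φ_xx cos(φ+θ) - φ_x² sin(φ+θ) - φ_tttt
  - φ_tt cos(φ+θ) + φ_t² sin(φ+θ) - cos(φ+θ) (φ_tt + sin(φ+θ)))`,
as a function of the values of `φ` and of its derivatives at a point. The arguments are complex so
that it can be linearized in the direction of complex perturbations. -/
def residual (a th u ux uxx ut utt uxxtt utttt : ℂ) : ℂ :=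
  uxx - (utt + Complex.sin (u + th)
    - a ^ 2 / 12 * (2 * uxxtt + 2 * uxx * Complex.cos (u + th) - ux ^ 2 * Complex.sin (u + th)
        - utttt - utt * Complex.cos (u + th) + ut ^ 2 * Complex.sin (u + th)
        - Complex.cos (u + th) * (utt + Complex.sin (u + th))))

/-- Left minus right side of the static equation
`φ_xx = sin(φ+θ) - a²/12 (2 φ_xx cos(φ+θ) - φ_x² sin(φ+θ) - cos(φ+θ) sin(φ+θ))`. -/
def staticResidual (a th u ux uxx : ℝ) : ℝ :=
  uxx - (Real.sin (u + th)
    - a ^ 2 / 12 * (2 * uxx * Real.cos (u + th) - ux ^ 2 * Real.sin (u + th)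
        - Real.cos (u + th) * Real.sin (u + th)))

/-- The static equation is the equation of motion without time derivatives. -/
theorem residual_static (a th u ux uxx : ℝ) :
    residual a th u ux uxx 0 0 0 0 = (staticResidual a th u ux uxx : ℂ) := by
  simp [residual, staticResidual]

/-- `φ` is a `3π`-kink of the model with lattice spacing `a`: a continuously differentiable static
solution (for `x ≠ 0`) with `φ_x ∈ H¹(ℝ)`, connecting `0` at `-∞` with `3π` at `+∞`. -/
structure IsThreePiKink (a : ℝ) (φ : ℝ → ℝ) : Prop where
  differentiable : Differentiable ℝ φ
  continuous_deriv : Continuous (deriv φ)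
  differentiable_deriv : ∀ x, x ≠ 0 → DifferentiableAt ℝ (deriv φ) x
  static : ∀ x, x ≠ 0 → staticResidual a (theta x) (φ x) (deriv φ x) (deriv (deriv φ) x) = 0
  memLp_deriv : MemLp (deriv φ) 2 volume
  memLp_deriv_deriv : MemLp (deriv (deriv φ)) 2 volume
  tendsto_atBot : Tendsto φ atBot (𝓝 0)
  tendsto_atTop : Tendsto φ atTop (𝓝 (3 * Real.pi))

/-- `v ∈ H²(ℝ)` with first and second derivative `v1` and `v2`: `v` is the continuously
differentiable representative, `v1` is an antiderivative of `v2` in the sense of Lebesgue, and all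
three are square integrable. -/
structure MemH2 (v v1 v2 : ℝ → ℂ) : Prop where
  hasDerivAt : ∀ x, HasDerivAt v (v1 x) x
  integral_eq : ∀ x y, ∫ t in x..y, v2 t = v1 y - v1 x
  memLp_zero : MemLp v 2 volume
  memLp_one : MemLp v1 2 volume
  memLp_two : MemLp v2 2 volume

/-- The linearization of the equation of motion about a static state in the direction
`e^{s t} v(x)`, at a point `x` and at `t = 0` (at other times it has an extra factor `e^{s t}`):
the derivative at `ε = 0` of the residual of `φ(x) + ε e^{s t} v(x)`. -/
def linearization (a th s u ux uxx v vx vxx : ℂ) : ℂ :=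
  deriv (fun ε : ℂ => residual a th (u + ε * v) (ux + ε * vx) (uxx + ε * vxx)
    (ε * (s * v)) (ε * (s ^ 2 * v)) (ε * (s ^ 2 * vxx)) (ε * (s ^ 4 * v))) 0

/-- `Λ` is an eigenvalue of the linearization about the static state `φ`: `Λ = s²`, where the
equation of motion linearized about `φ` has a solution `e^{s t} v(x)` with `0 ≠ v ∈ H²(ℝ)`. -/
def IsEigenvalue (a : ℝ) (φ : ℝ → ℝ) (Λ : ℂ) : Prop :=
  ∃ s : ℂ, s ^ 2 = Λ ∧ ∃ v v1 v2 : ℝ → ℂ, MemH2 v v1 v2 ∧ v ≠ 0 ∧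
    ∀ᵐ x : ℝ, linearization a (theta x) s (φ x : ℝ) (deriv φ x : ℝ) (deriv (deriv φ) x : ℝ)
      (v x) (v1 x) (v2 x) = 0

/-- All eigenvalues of the linearization about `φ` are real, and `Λ` is the largest of them. -/
def IsLargestEigenvalue (a : ℝ) (φ : ℝ → ℝ) (Λ : ℝ) : Prop :=
  IsEigenvalue a φ Λ ∧ ∀ μ : ℂ, IsEigenvalue a φ μ → μ.im = 0 ∧ μ.re ≤ Λ

/-- The linearization written out. It depends on `s` only through `s²`. -/
theorem linearization_eq (a th s u ux uxx v vx vxx : ℂ) :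
    linearization a th s u ux uxx v vx vxx =
      vxx - Complex.cos (u + th) * v
        + a ^ 2 / 12 * (2 * Complex.cos (u + th) * vxx - 2 * ux * Complex.sin (u + th) * vx
            + (1 - 2 * Complex.cos (u + th) ^ 2 - 2 * uxx * Complex.sin (u + th)
                - ux ^ 2 * Complex.cos (u + th)) * v)
        - s ^ 2 * v
        + a ^ 2 / 12 * (2 * s ^ 2 * vxx - 2 * s ^ 2 * Complex.cos (u + th) * v
            - (s ^ 2) ^ 2 * v) := by
  have lin : ∀ p q : ℂ, HasDerivAt (fun ε : ℂ => p + ε * q) q 0 := fun p q => by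
    simpa using ((hasDerivAt_id (0 : ℂ)).mul_const q).const_add p
  have lin0 : ∀ q : ℂ, HasDerivAt (fun ε : ℂ => ε * q) q 0 := fun q => by
    simpa using (hasDerivAt_id (0 : ℂ)).mul_const q
  have hu := (lin u v).add_const th
  have hs := hu.csin
  have hc := hu.ccos
  have h := (lin uxx vxx).sub (((lin0 (s ^ 2 * v)).add hs).sub
    (((((((((lin0 (s ^ 2 * vxx)).const_mul 2).add (((lin uxx vxx).const_mul 2).mul hc)).sub
      (((lin ux vx).pow 2).mul hs)).sub (lin0 (s ^ 4 * v))).sub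
      ((lin0 (s ^ 2 * v)).mul hc)).add (((lin0 (s * v)).pow 2).mul hs)).sub
      (hc.mul ((lin0 (s ^ 2 * v)).add hs))).const_mul (a ^ 2 / 12)))
  have h2 := h.deriv
  unfold linearization residual
  refine Eq.trans h2 ?_
  simp only [Pi.pow_apply, Pi.add_apply, zero_mul, add_zero, zero_add]
  have e := Complex.sin_sq_add_cos_sq (u + th)
  have e' : Complex.sin (u + th) ^ 2 = 1 - Complex.cos (u + th) ^ 2 := by
    rw [← e]; ring
  norm_num
  ring_nf
  rw [e']
  ring

end LatticeKink

end

/-! Write `e = a² / 12` and `H` for `speedSq`. The static equation has a first integral on each half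
line, and square integrability of `φ_x` fixes its constant. The reflection `x ↦ 3π - φ(-x)`
preserves kinks; comparing the two first integrals at `x = 0` gives `cos φ(0) = 0`, hence `φ(0) =
3π/2`. On `x ≤ 0` the coordinate `y` with `φ = 4 arctan (exp y)` therefore obeys `dy/dx = √H(tanh
y)` and ends at `y₀`, where `tanh y₀ = √2/2`. The right half is the reflection of such a piece.
Solving this scalar equation also produces a kink (`exists_kink`).

Along this profile the linearization is `((p + 2eΛ) v')' = (V + Λp + eΛ²) v`, a problem quadratic in
`Λ`. If `v > 0` is an eigenfunction, `R = (p + 2eΛ) v'/v` solves a Riccati equation. Conversely, a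
bounded global solution `R`, positive near `-∞` and negative near `+∞`, integrates to an
eigenfunction (`SturmData.exists_eigenfunction`) and, by completing a square, excludes larger real
eigenvalues (`SturmData.re_le`). Nonreal ones are excluded by a real parameter at which the
quadratic form is nonpositive (`SturmData.im_eq_zero`). It suffices to find `R` on the left half
with `R = 0` at `x = 0` and to reflect it oddly. For `Z = √H R` as a function of `y` the
coefficients are rational in `tanh y`, `e` and `Λ`, and the condition becomes `Z y₀ = 0`.

For `e = 0` the solution comes from `v = exp (μ y) (μ - tanh y)` with `μ² = 1 + Λ`, and `Z y₀ = 0`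
gives `Λ = (√5 - 1)/4`. The implicit function theorem for `(Λ, Z)` in `ℝ × (ℝ →ᵇ ℝ)` continues it to
a C² branch in `e`; the linearized Riccati operator `D' + 2 Z₀ D` is inverted with the weight `v²`.
The first-order correction is explicit (`hasDerivAt_firstCorr`), so the derivative of the branch is
`slope = 7/(4√5)`. Being C² gives the error `O(e²) = O(a⁴)`, and positivity of `slope` gives
monotonicity. -/

noncomputable section

namespace LatticeKink

open scoped BoundedContinuousFunction ContDiff ComplexConjugate

/-! ### Weighted primitives on the line -/

/-- A positive continuous weight whose primitive from `-∞` is dominated by the weight itself. -/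
structure DecayWeight (w : ℝ → ℝ) (K : ℝ) : Prop where
  pos : ∀ y, 0 < w y
  cont : Continuous w
  int : ∀ y, IntegrableOn w (Iic y)
  le : ∀ y, ∫ t in Iic y, w t ≤ K * w y

theorem hasDerivAt_integral_Iic {g : ℝ → ℝ} (hg : Continuous g)
    (hi : ∀ y, IntegrableOn g (Iic y)) (y : ℝ) :
    HasDerivAt (fun y => ∫ t in Iic y, g t) (g y) y := by
  have h : (fun y => ∫ t in Iic y, g t) = fun y => (∫ t in Iic 0, g t) + ∫ t in (0 : ℝ)..y, g t := by
    funext z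
    rw [← intervalIntegral.integral_Iic_sub_Iic (hi 0) (hi z)]
    ring
  rw [h]
  exact (intervalIntegral.integral_hasDerivAt_right (hg.intervalIntegrable _ _)
    hg.stronglyMeasurable.stronglyMeasurableAtFilter hg.continuousAt).const_add _

namespace DecayWeight

variable {w : ℝ → ℝ} {K : ℝ}

theorem integrableOn_mul (hw : DecayWeight w K) (f : ℝ →ᵇ ℝ) (y : ℝ) :
    IntegrableOn (fun t => w t * f t) (Iic y) :=
  (hw.int y).mul_bdd (c := ‖f‖) f.continuous.aestronglyMeasurable
    (Eventually.of_forall fun x => f.norm_coe_le_norm x)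

/-- `f ↦ w⁻¹ ∫_{-∞}^y w f`. -/
def prim (w : ℝ → ℝ) (f : ℝ → ℝ) (y : ℝ) : ℝ := (w y)⁻¹ * ∫ t in Iic y, w t * f t

/-- With `w' = 2 g w` the weighted primitive is a right inverse of `D ↦ D' + 2 g D`, the
linearization of the Riccati operator `Z' + Z²` at `g`. -/
theorem hasDerivAt_prim (hw : DecayWeight w K) {g : ℝ → ℝ}
    (hd : ∀ y, HasDerivAt w (2 * g y * w y) y) (f : ℝ →ᵇ ℝ) (y : ℝ) :
    HasDerivAt (prim w f) (f y - 2 * g y * prim w f y) y := by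
  have h1 := hasDerivAt_integral_Iic (hw.cont.mul f.continuous) (hw.integrableOn_mul f) y
  have h2 := ((hd y).inv (hw.pos y).ne').mul h1
  refine h2.congr_deriv ?_
  have := (hw.pos y).ne'
  simp only [prim, Pi.inv_apply, Pi.mul_apply]
  field_simp
  ring

theorem abs_prim_le (hw : DecayWeight w K) (f : ℝ →ᵇ ℝ) (y : ℝ) :
    ‖prim w f y‖ ≤ K * ‖f‖ := by
  have h1 : ‖∫ t in Iic y, w t * f t‖ ≤ ∫ t in Iic y, w t * ‖f‖ := by
    refine norm_integral_le_of_norm_le ((hw.int y).mul_const _) (Eventually.of_forall fun t => ?_)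
    rw [norm_mul, Real.norm_of_nonneg (hw.pos t).le]
    exact mul_le_mul_of_nonneg_left (f.norm_coe_le_norm t) (hw.pos t).le
  rw [integral_mul_const] at h1
  have h2 := mul_le_mul_of_nonneg_right (hw.le y) (norm_nonneg f)
  rw [prim, norm_mul, norm_inv, Real.norm_of_nonneg (hw.pos y).le, inv_mul_le_iff₀ (hw.pos y)]
  nlinarith

theorem continuous_prim (hw : DecayWeight w K) (f : ℝ →ᵇ ℝ) : Continuous (prim w f) :=
  (hw.cont.inv₀ fun y => (hw.pos y).ne').mul (continuous_iff_continuousAt.2 fun y =>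
    (hasDerivAt_integral_Iic (hw.cont.mul f.continuous) (hw.integrableOn_mul f) y).continuousAt)

/-- The weighted primitive as a continuous operator on bounded continuous functions. -/
def op (hw : DecayWeight w K) : (ℝ →ᵇ ℝ) →L[ℝ] (ℝ →ᵇ ℝ) :=
  LinearMap.mkContinuous
    { toFun := fun f => BoundedContinuousFunction.ofNormedAddCommGroup (prim w f)
        (hw.continuous_prim f) (K * ‖f‖) (hw.abs_prim_le f)
      map_add' := fun f g => by
        ext y
        simp only [BoundedContinuousFunction.coe_ofNormedAddCommGroup, prim,
          BoundedContinuousFunction.coe_add, Pi.add_apply, mul_add]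
        rw [integral_add (hw.integrableOn_mul f y) (hw.integrableOn_mul g y), mul_add]
      map_smul' := fun c f => by
        ext y
        simp only [BoundedContinuousFunction.coe_ofNormedAddCommGroup, prim,
          BoundedContinuousFunction.coe_smul, smul_eq_mul, RingHom.id_apply]
        simp_rw [mul_left_comm _ c]
        rw [integral_const_mul]
        ring } K
    (fun f => BoundedContinuousFunction.norm_ofNormedAddCommGroup_le _
      ((norm_nonneg _).trans (hw.abs_prim_le f 0)) (hw.abs_prim_le f))

theorem op_apply (hw : DecayWeight w K) (f : ℝ →ᵇ ℝ) (y : ℝ) : hw.op f y = prim w f y := rfl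

theorem hasDerivAt_op (hw : DecayWeight w K) {g : ℝ → ℝ}
    (hd : ∀ y, HasDerivAt w (2 * g y * w y) y) (f : ℝ →ᵇ ℝ) (y : ℝ) :
    HasDerivAt (hw.op f) (f y - 2 * g y * hw.op f y) y :=
  hw.hasDerivAt_prim hd f y

/-- At `y₀` this is the nondegeneracy condition of the implicit function theorem: `op 1` is the
response of the Riccati solution to the spectral parameter. -/
theorem op_one_pos (hw : DecayWeight w K) (y : ℝ) : 0 < hw.op 1 y := by
  rw [op_apply, prim]
  refine mul_pos (inv_pos.2 (hw.pos y)) ?_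
  simp only [BoundedContinuousFunction.coe_one, Pi.one_apply, mul_one]
  rw [setIntegral_pos_iff_support_of_nonneg_ae (Eventually.of_forall fun t => (hw.pos t).le)
    (hw.int y)]
  have : Function.support w = univ := by
    ext t; simp [(hw.pos t).ne']
  simp [this]

/-- A bounded solution of `D' + 2 g D = f` is the weighted primitive of `f`. -/
theorem eq_op (hw : DecayWeight w K) {g : ℝ → ℝ}
    (hd : ∀ y, HasDerivAt w (2 * g y * w y) y) (h0 : Tendsto w atBot (𝓝 0)) {f D : ℝ →ᵇ ℝ}
    (hD : ∀ y, HasDerivAt D (f y - 2 * g y * D y) y) : D = hw.op f := by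
  ext y
  have h1 : ∀ x ∈ Iic y, HasDerivAt (fun t => w t * D t) (w x * f x) x := fun x _ => by
    refine ((hd x).mul (hD x)).congr_deriv ?_
    ring
  -- Boundedness of `D` excludes the homogeneous solution `w⁻¹`, which blows up at `-∞`.
  have h2 : Tendsto (fun t => w t * D t) atBot (𝓝 0) := by
    refine squeeze_zero_norm (a := fun t => w t * ‖D‖) (fun t => ?_) (by simpa using h0.mul_const ‖D‖)
    rw [norm_mul, Real.norm_of_nonneg (hw.pos t).le]
    exact mul_le_mul_of_nonneg_left (D.norm_coe_le_norm t) (hw.pos t).le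
  have h3 := integral_Iic_of_hasDerivAt_of_tendsto' h1 (hw.integrableOn_mul f y) h2
  rw [op_apply, prim, h3]
  have := (hw.pos y).ne'
  field_simp
  ring

end DecayWeight

/-! ### Calculus of the hyperbolic tangent -/

theorem hasDerivAt_tanh (y : ℝ) : HasDerivAt Real.tanh (1 - Real.tanh y ^ 2) y := by
  have h := (Real.hasDerivAt_sinh y).div (Real.hasDerivAt_cosh y) (Real.cosh_pos y).ne'
  have e : (fun y => Real.sinh y / Real.cosh y) = Real.tanh := by
    funext y; rw [Real.tanh_eq_sinh_div_cosh]
  rw [show Real.sinh / Real.cosh = Real.tanh from e] at h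
  refine h.congr_deriv ?_
  rw [Real.tanh_eq_sinh_div_cosh]
  have := (Real.cosh_pos y).ne'
  field_simp

theorem continuous_tanh : Continuous Real.tanh :=
  continuous_iff_continuousAt.2 fun y => (hasDerivAt_tanh y).continuousAt

theorem abs_tanh_le (y : ℝ) : |Real.tanh y| ≤ 1 :=
  abs_le.2 ⟨(Real.neg_one_lt_tanh y).le, (Real.tanh_lt_one y).le⟩

theorem tanh_sq_le (y : ℝ) : Real.tanh y ^ 2 ≤ 1 := (sq_le_one_iff_abs_le_one _).2 (abs_tanh_le y)

/-! ### Coefficients of the linearization in the variable `T = tanh y`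

With `φ = 4 arctan (exp y)` one has `cos φ = 2 T² - 1`, and all coefficients are rational in `T` and
`e = a² / 12`. They are written over an arbitrary ring, with the inverses as extra arguments, so that
they can be used both for numbers and for elements of a Banach algebra. -/

section Ring

variable {R : Type*} [CommRing R]

/-- `1 + 2 e cos φ`. -/
def stiffness (e T : R) : R := 1 - 2 * e + 4 * e * T ^ 2

/-- The coefficient of order zero of the static linearization is `2 T ^ 2 - 1 - e * potentialCorr`;
here `iP` stands for the inverse of the stiffness. -/
def potentialCorr (e T iP : R) : R :=
  1 - 2 * (2 * T ^ 2 - 1) ^ 2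
    - 8 * T ^ 2 * (1 - T ^ 2) * (1 + 4 * e * (1 - T ^ 2) * ((1 + e * T ^ 2) * iP)
        + e * (2 * T ^ 2 - 1)) * iP
    - 4 * (1 - T ^ 2) * ((1 + e * T ^ 2) * iP) * (2 * T ^ 2 - 1)

def potentialPoly (e L T iP : R) : R :=
  2 * T ^ 2 - 1 - e * potentialCorr e T iP + L * stiffness e T + e * L ^ 2

/-- Half the logarithmic derivative of `speedSq` in `y`; `iP` and `iQ` stand for the inverses of the
stiffness and of `1 + e T²`. -/
def dampingPoly (e T iP iQ : R) : R := e * ((1 - T ^ 2) * (T * iQ - 4 * T * iP))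

/-- Arranged so that `Z` solves the perturbed Riccati equation exactly when `D = Z - Z₀` solves `D'
+ 2 Z₀ D = riccatiDefect`. At the unperturbed solution its derivative in `Z` vanishes. -/
def riccatiDefect (e L L₀ Z Z₀ T iP iQ iS : R) : R :=
  potentialPoly e L T iP - (2 * T ^ 2 - 1 + L₀) + dampingPoly e T iP iQ * Z
    - stiffness e T * iQ * iS * Z ^ 2 + 2 * Z₀ * Z - Z₀ ^ 2

end Ring

/-- `φ_x² / φ_y²` for the kink. -/
def speedSq (e T : ℝ) : ℝ := (1 + e * T ^ 2) * (stiffness e T)⁻¹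

/-- The potential of the linearization, including the spectral parameter `L`. -/
def potential (e L T : ℝ) : ℝ := potentialPoly e L T (stiffness e T)⁻¹

def damping (e T : ℝ) : ℝ := dampingPoly e T (stiffness e T)⁻¹ (1 + e * T ^ 2)⁻¹

/-- The inverse of `speedSq` times `p + 2 e L`: the coefficient of the square after the scaling `Z =
√speedSq * R`. -/
def quadCoeff (e L T : ℝ) : ℝ :=
  stiffness e T * (1 + e * T ^ 2)⁻¹ * (stiffness e T + 2 * e * L)⁻¹

/-! ### The explicit solution for `e = 0` -/

/-- The positive root of `μ (μ - √2/2) = 1/2`, which is the condition `Z y₀ = 0` for `e = 0`. -/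
def mu : ℝ := √2 * (1 + √5) / 4

def lam₀ : ℝ := (√5 - 1) / 4

/-- The coordinate of the junction: here `4 arctan (exp y)` takes the value `3π/2`. -/
def y₀ : ℝ := Real.arsinh 1

theorem tanh_y₀ : Real.tanh y₀ = √2 / 2 := by
  rw [y₀, Real.tanh_arsinh, one_pow, one_add_one_eq_two, div_eq_div_iff (by positivity) (by norm_num)]
  rw [Real.mul_self_sqrt (by norm_num)]
  ring

theorem mu_sq : mu ^ 2 = lam₀ + 1 := by
  have h2 : √2 ^ 2 = 2 := Real.sq_sqrt (by norm_num)
  have h5 : √5 ^ 2 = 5 := Real.sq_sqrt (by norm_num)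
  rw [mu, lam₀]
  linear_combination (1 + √5) ^ 2 / 16 * h2 + 1 / 8 * h5

theorem sqrt_five_bounds : 2.2 < √5 ∧ √5 < 2.25 :=
  ⟨Real.lt_sqrt_of_sq_lt (by norm_num), (Real.sqrt_lt' (by norm_num)).2 (by norm_num)⟩

theorem mu_bounds : 1.1 < mu ∧ mu < 1.2 := by
  have h0 : 0 < mu := by unfold mu; positivity
  have := sqrt_five_bounds
  have h := mu_sq
  unfold lam₀ at h
  constructor <;> nlinarith

theorem lam₀_bounds : 0.3 ≤ lam₀ ∧ lam₀ ≤ 0.32 := by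
  have := sqrt_five_bounds
  unfold lam₀
  constructor <;> linarith

theorem mu_sub_pos {T : ℝ} (hT : T ≤ 1) : 0 < mu - T := by linarith [mu_bounds.1]

/-- The solution of the Riccati equation for `e = 0`. -/
def zBase (T : ℝ) : ℝ := mu - (1 - T ^ 2) / (mu - T)

/-- `zBase` is the logarithmic derivative of `exp (mu y) (mu - tanh y)`, the solution decaying at
`-∞` of `v'' = (2 tanh² - 1 + lam₀) v`; `wBase` below is the square of this solution. -/
theorem hasDerivAt_zBase (y : ℝ) :
    HasDerivAt (fun y => zBase (Real.tanh y))
      (2 * Real.tanh y ^ 2 - 1 + lam₀ - zBase (Real.tanh y) ^ 2) y := by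
  have ht := hasDerivAt_tanh y
  have hp := (mu_sub_pos (Real.tanh_lt_one y).le).ne'
  have h := (((ht.pow 2).const_sub 1).div (ht.const_sub mu) hp).const_sub mu
  refine h.congr_deriv ?_
  have hl : lam₀ = mu ^ 2 - 1 := by linarith [mu_sq]
  simp only [zBase, hl, Pi.pow_apply]
  field_simp
  ring

theorem zBase_y₀ : zBase (Real.tanh y₀) = 0 := by
  have hp := (mu_sub_pos (Real.tanh_lt_one y₀).le).ne'
  rw [zBase, sub_eq_zero, eq_div_iff hp, tanh_y₀]
  have h2 : √2 ^ 2 = 2 := Real.sq_sqrt (by norm_num)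
  have h := mu_sq
  rw [lam₀] at h
  have : mu * √2 = (1 + √5) / 2 := by rw [mu]; linear_combination (1 + √5) / 4 * h2
  linear_combination h - this / 2 + h2 / 4

def wBase (y : ℝ) : ℝ := Real.exp (2 * mu * y) * (mu - Real.tanh y) ^ 2

theorem hasDerivAt_wBase (y : ℝ) :
    HasDerivAt wBase (2 * zBase (Real.tanh y) * wBase y) y := by
  have ht := hasDerivAt_tanh y
  have hp := (mu_sub_pos (Real.tanh_lt_one y).le).ne'
  have h := (((hasDerivAt_id y).const_mul (2 * mu)).exp).mul ((ht.const_sub mu).pow 2)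
  refine h.congr_deriv ?_
  simp only [zBase, wBase, Pi.pow_apply, id]
  field_simp
  ring

theorem wBase_le (y : ℝ) : wBase y ≤ 9 * Real.exp (2 * mu * y) := by
  have h1 := Real.neg_one_lt_tanh y
  have h2 := Real.tanh_lt_one y
  have h3 := mu_bounds
  rw [wBase, mul_comm]
  exact mul_le_mul_of_nonneg_right (by nlinarith) (Real.exp_pos _).le

theorem le_wBase (y : ℝ) : Real.exp (2 * mu * y) / 100 ≤ wBase y := by
  have h2 := Real.tanh_lt_one y
  have h3 := mu_bounds
  rw [wBase, div_eq_mul_inv]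
  exact mul_le_mul_of_nonneg_left (by nlinarith) (Real.exp_pos _).le

/-- Since `0.1 < mu - tanh y < 3`, the weight lies between `1/100` and `9` times `exp (2 mu y)`; the
ratio of these constants is `900`. -/
theorem decayWeight_wBase : DecayWeight wBase (900 / (2 * mu)) := by
  have hm : 0 < 2 * mu := by linarith [mu_bounds.1]
  have hc : Continuous wBase := continuous_iff_continuousAt.2 fun y =>
    (hasDerivAt_wBase y).continuousAt
  have hpos : ∀ y, 0 < wBase y := fun y => lt_of_lt_of_le (by positivity) (le_wBase y)
  have hi : ∀ y, IntegrableOn (fun t => 9 * Real.exp (2 * mu * t)) (Iic y) := fun y =>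
    (integrableOn_exp_mul_Iic hm y).const_mul 9
  have hint : ∀ y, IntegrableOn wBase (Iic y) := fun y =>
    (hi y).mono' hc.aestronglyMeasurable (Eventually.of_forall fun t => by
      rw [Real.norm_of_nonneg (hpos t).le]; exact wBase_le t)
  refine ⟨hpos, hc, hint, fun y => ?_⟩
  refine (integral_mono (hint y) (hi y) wBase_le).trans ?_
  rw [integral_const_mul, integral_exp_mul_Iic hm]
  have := le_wBase y
  rw [div_mul_eq_mul_div, mul_div_assoc', div_le_div_iff_of_pos_right hm]
  linarith

theorem tendsto_wBase : Tendsto wBase atBot (𝓝 0) := by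
  have hm : 0 < 2 * mu := by linarith [mu_bounds.1]
  have h : Tendsto (fun y => 9 * Real.exp (2 * mu * y)) atBot (𝓝 (9 * 0)) :=
    (Real.tendsto_exp_atBot.comp (tendsto_id.const_mul_atBot hm)).const_mul 9
  rw [mul_zero] at h
  exact squeeze_zero (fun y => (decayWeight_wBase.pos y).le) wBase_le h

/-! ### The first order correction -/

/-- The derivative of the Riccati equation in `e` at `e = 0`. -/
def firstDefect (T : ℝ) : ℝ :=
  -3 + 12 * T ^ 2 - 8 * T ^ 4 + lam₀ * (4 * T ^ 2 - 2) + lam₀ ^ 2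
    - 3 * T * (1 - T ^ 2) * zBase T + (T ^ 2 + 2 * lam₀) * zBase T ^ 2

/-- The number for which the bounded solution of `D' + 2 zBase D = firstDefect + slope` vanishes at
`y₀`. -/
def slope : ℝ := 7 / (4 * √5)

/-- The bounded solution times `wBase` is `exp (2 mu y)` times this polynomial in `T = tanh y`,
which explains the denominator in `firstCorr`. -/
def firstCorrPoly (T : ℝ) : ℝ :=
  √2 / 2 * (7 / 8 + √5 / 10) + (-25 / 8 - 39 / 40 * √5) * T + √2 / 2 * (21 / 4 + 3 * √5) * T ^ 2
    + (-3 / 4 - √5 / 4) * T ^ 3 - √2 * (1 + √5) * T ^ 4 + 2 * T ^ 5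

def firstCorr (T : ℝ) : ℝ := firstCorrPoly T / (mu - T) ^ 2

theorem firstCorr_y₀ : firstCorr (Real.tanh y₀) = 0 := by
  rw [firstCorr, tanh_y₀, firstCorrPoly]
  have h2 : √2 ^ 2 = 2 := Real.sq_sqrt (by norm_num)
  have h3 : √2 ^ 3 = 2 * √2 := by rw [pow_succ, h2]
  have h4 : √2 ^ 4 = 4 := by rw [show √2 ^ 4 = (√2 ^ 2) ^ 2 by ring, h2]; norm_num
  have h5 : √2 ^ 5 = 4 * √2 := by rw [pow_succ, h4]
  rw [div_eq_zero_iff]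
  left
  ring_nf
  rw [h5, h3]
  ring

theorem hasDerivAt_firstCorr (y : ℝ) :
    HasDerivAt (fun y => firstCorr (Real.tanh y))
      (firstDefect (Real.tanh y) + slope - 2 * zBase (Real.tanh y) * firstCorr (Real.tanh y)) y := by
  have ht := hasDerivAt_tanh y
  have hp := (mu_sub_pos (Real.tanh_lt_one y).le).ne'
  set T := Real.tanh y with hT
  have hpoly : HasDerivAt (fun y => firstCorrPoly (Real.tanh y))
      (((-25 / 8 - 39 / 40 * √5) + √2 * (21 / 4 + 3 * √5) * T
        + 3 * (-3 / 4 - √5 / 4) * T ^ 2 - 4 * (√2 * (1 + √5)) * T ^ 3 + 10 * T ^ 4)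
        * (1 - T ^ 2)) y := by
    have h := (((((ht.const_mul (-25 / 8 - 39 / 40 * √5)).const_add
      (√2 / 2 * (7 / 8 + √5 / 10))).add ((ht.pow 2).const_mul (√2 / 2 * (21 / 4 + 3 * √5)))).add
      ((ht.pow 3).const_mul (-3 / 4 - √5 / 4))).sub ((ht.pow 4).const_mul (√2 * (1 + √5)))).add
      ((ht.pow 5).const_mul 2)
    refine h.congr_deriv ?_
    simp only [← hT]
    push_cast
    ring
  have h := hpoly.div ((ht.const_sub mu).pow 2) (pow_ne_zero 2 hp)
  refine h.congr_deriv ?_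
  simp only [Pi.pow_apply, ← hT, firstCorr, firstDefect, zBase]
  have h2 : √2 ^ 2 = 2 := Real.sq_sqrt (by norm_num)
  have h5 : √5 ^ 2 = 5 := Real.sq_sqrt (by norm_num)
  have hs : slope = 7 / 20 * √5 := by
    rw [slope, div_eq_iff (by positivity)]
    linear_combination -7 / 5 * h5
  -- The differential equation with denominators cleared: an identity of polynomials in `T` over
  -- `ℚ(√2, √5)`.
  have key : (-25 / 8 - 39 / 40 * √5 + √2 * (21 / 4 + 3 * √5) * T
        + 3 * (-3 / 4 - √5 / 4) * T ^ 2 - 4 * (√2 * (1 + √5)) * T ^ 3 + 10 * T ^ 4) * (1 - T ^ 2)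
        + 2 * mu * firstCorrPoly T
      = (-3 + 12 * T ^ 2 - 8 * T ^ 4 + lam₀ * (4 * T ^ 2 - 2) + lam₀ ^ 2 + slope) * (mu - T) ^ 2
        - 3 * T * (1 - T ^ 2) * (mu * (mu - T) - (1 - T ^ 2)) * (mu - T)
        + (T ^ 2 + 2 * lam₀) * (mu * (mu - T) - (1 - T ^ 2)) ^ 2 := by
    rw [hs, firstCorrPoly, mu, lam₀]
    have h3 : √2 ^ 3 = 2 * √2 := by rw [pow_succ, h2]
    have h4 : √2 ^ 4 = 4 := by rw [show √2 ^ 4 = (√2 ^ 2) ^ 2 by ring, h2]; norm_num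
    have h53 : √5 ^ 3 = 5 * √5 := by rw [pow_succ, h5]
    have h54 : √5 ^ 4 = 25 := by rw [show √5 ^ 4 = (√5 ^ 2) ^ 2 by ring, h5]; norm_num
    have h55 : √5 ^ 5 = 25 * √5 := by rw [pow_succ, h54]
    ring_nf
    simp only [h2, h3, h4, h5, h53, h54, h55]
    ring
  -- With the numerator and its derivative opaque, only powers of `mu - T` remain to be cleared.
  generalize firstCorrPoly T = p at key ⊢
  generalize (-25 / 8 - 39 / 40 * √5 + √2 * (21 / 4 + 3 * √5) * T
        + 3 * (-3 / 4 - √5 / 4) * T ^ 2 - 4 * (√2 * (1 + √5)) * T ^ 3 + 10 * T ^ 4) = p' at key ⊢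
  field_simp
  linear_combination (mu - T) ^ 2 * key

/-! ### The Riccati equation as an equation in a Banach algebra -/

/-- A continuous function on `[-1, 1]` composed with `tanh`. -/
theorem exists_bcf_comp_tanh {F : ℝ → ℝ} (hF : ContinuousOn F (Icc (-1) 1)) :
    ∃ f : ℝ →ᵇ ℝ, ∀ y, f y = F (Real.tanh y) := by
  have hm : ∀ y, Real.tanh y ∈ Icc (-1 : ℝ) 1 := fun y =>
    ⟨(Real.neg_one_lt_tanh y).le, (Real.tanh_lt_one y).le⟩
  obtain ⟨C, hC⟩ := isCompact_Icc.exists_bound_of_continuousOn hF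
  refine ⟨BoundedContinuousFunction.ofNormedAddCommGroup (fun y => F (Real.tanh y))
    (hF.comp_continuous continuous_tanh hm) C fun y => hC _ (hm y), fun y => rfl⟩

def tanhB : ℝ →ᵇ ℝ := (exists_bcf_comp_tanh continuousOn_id).choose

theorem tanhB_apply (y : ℝ) : tanhB y = Real.tanh y :=
  (exists_bcf_comp_tanh continuousOn_id).choose_spec y

theorem continuousOn_zBase : ContinuousOn zBase (Icc (-1) 1) := by
  unfold zBase
  refine continuousOn_const.sub (ContinuousOn.div (by fun_prop) (by fun_prop) fun x hx => ?_)
  exact (mu_sub_pos hx.2).ne'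

def zBaseB : ℝ →ᵇ ℝ := (exists_bcf_comp_tanh continuousOn_zBase).choose

theorem zBaseB_apply (y : ℝ) : zBaseB y = zBase (Real.tanh y) :=
  (exists_bcf_comp_tanh continuousOn_zBase).choose_spec y

theorem continuousOn_firstDefect : ContinuousOn firstDefect (Icc (-1) 1) := by
  have := continuousOn_zBase
  unfold firstDefect
  fun_prop

def firstDefectB : ℝ →ᵇ ℝ := (exists_bcf_comp_tanh continuousOn_firstDefect).choose

theorem firstDefectB_apply (y : ℝ) : firstDefectB y = firstDefect (Real.tanh y) :=
  (exists_bcf_comp_tanh continuousOn_firstDefect).choose_spec y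

theorem continuousOn_firstCorr : ContinuousOn firstCorr (Icc (-1) 1) := by
  unfold firstCorr firstCorrPoly
  refine ContinuousOn.div (by fun_prop) (by fun_prop) fun x hx => ?_
  exact pow_ne_zero 2 (mu_sub_pos hx.2).ne'

def firstCorrB : ℝ →ᵇ ℝ := (exists_bcf_comp_tanh continuousOn_firstCorr).choose

theorem firstCorrB_apply (y : ℝ) : firstCorrB y = firstCorr (Real.tanh y) :=
  (exists_bcf_comp_tanh continuousOn_firstCorr).choose_spec y

/-! ### The Riccati defect as a C² map -/

theorem ringInverse_apply {f : ℝ →ᵇ ℝ} (hf : IsUnit f) (y : ℝ) : Ring.inverse f y = (f y)⁻¹ := by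
  have h : (Ring.inverse f * f) y = 1 := by rw [Ring.inverse_mul_cancel f hf]; rfl
  rw [BoundedContinuousFunction.coe_mul, Pi.mul_apply] at h
  exact eq_inv_of_mul_eq_one_left h

/-- The triples `(e, Λ, Z)`. -/
abbrev Param := ℝ × ℝ × (ℝ →ᵇ ℝ)

def denP (p : Param) : ℝ →ᵇ ℝ := stiffness (p.1 • 1) tanhB
def denQ (p : Param) : ℝ →ᵇ ℝ := 1 + (p.1 • 1) * tanhB ^ 2
def denS (p : Param) : ℝ →ᵇ ℝ := stiffness (p.1 • 1) tanhB + 2 * (p.1 • 1) * (p.2.1 • 1)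

def defectB (p : Param) : ℝ →ᵇ ℝ :=
  riccatiDefect (p.1 • 1) (p.2.1 • 1) (lam₀ • 1) p.2.2 zBaseB tanhB
    (Ring.inverse (denP p)) (Ring.inverse (denQ p)) (Ring.inverse (denS p))

def baseParam : Param := (0, lam₀, zBaseB)

theorem contDiff_denP : ContDiff ℝ 2 denP := by unfold denP stiffness; fun_prop
theorem contDiff_denQ : ContDiff ℝ 2 denQ := by unfold denQ; fun_prop
theorem contDiff_denS : ContDiff ℝ 2 denS := by unfold denS stiffness; fun_prop

theorem den_base : denP baseParam = 1 ∧ denQ baseParam = 1 ∧ denS baseParam = 1 := by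
  simp [denP, denQ, denS, baseParam, stiffness]

/-- Inversion in a Banach algebra is smooth at units, and all three denominators are `1` at the base
point. This replaces estimates of quotients of functions. -/
theorem contDiffAt_inverse_comp {d : Param → (ℝ →ᵇ ℝ)} (hd : ContDiff ℝ 2 d)
    (h1 : d baseParam = 1) : ContDiffAt ℝ 2 (fun p => Ring.inverse (d p)) baseParam := by
  have h := contDiffAt_ringInverse ℝ (n := 2) (1 : (ℝ →ᵇ ℝ)ˣ)
  exact ContDiffAt.comp (g := Ring.inverse) baseParam (by rw [h1]; exact h) hd.contDiffAt

theorem contDiffAt_defectB : ContDiffAt ℝ 2 defectB baseParam := by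
  have hP := contDiffAt_inverse_comp contDiff_denP den_base.1
  have hQ := contDiffAt_inverse_comp contDiff_denQ den_base.2.1
  have hS := contDiffAt_inverse_comp contDiff_denS den_base.2.2
  unfold defectB riccatiDefect potentialPoly dampingPoly potentialCorr stiffness
  fun_prop

theorem eventually_isUnit {d : Param → (ℝ →ᵇ ℝ)} (hd : ContDiff ℝ 2 d)
    (h1 : d baseParam = 1) : ∀ᶠ p in 𝓝 baseParam, IsUnit (d p) :=
  hd.continuous.continuousAt.eventually (Units.isOpen.mem_nhds (by rw [h1]; exact isUnit_one))

theorem eventually_defectB_apply : ∀ᶠ p in 𝓝 baseParam, ∀ y,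
    defectB p y = potential p.1 p.2.1 (Real.tanh y) - (2 * Real.tanh y ^ 2 - 1 + lam₀)
      + damping p.1 (Real.tanh y) * p.2.2 y - quadCoeff p.1 p.2.1 (Real.tanh y) * p.2.2 y ^ 2
      + 2 * zBase (Real.tanh y) * p.2.2 y - zBase (Real.tanh y) ^ 2 := by
  filter_upwards [eventually_isUnit contDiff_denP den_base.1,
    eventually_isUnit contDiff_denQ den_base.2.1,
    eventually_isUnit contDiff_denS den_base.2.2] with p hP hQ hS y
  have two : (2 : ℝ →ᵇ ℝ) y = 2 := rfl
  have four : (4 : ℝ →ᵇ ℝ) y = 4 := rfl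
  have eight : (8 : ℝ →ᵇ ℝ) y = 8 := rfl
  have eP : Ring.inverse (denP p) y = (stiffness p.1 (Real.tanh y))⁻¹ := by
    rw [ringInverse_apply hP]
    simp [denP, stiffness, tanhB_apply]
    ring
  have eQ : Ring.inverse (denQ p) y = (1 + p.1 * Real.tanh y ^ 2)⁻¹ := by
    rw [ringInverse_apply hQ]
    simp [denQ, tanhB_apply]
  have eS : Ring.inverse (denS p) y = (stiffness p.1 (Real.tanh y) + 2 * p.1 * p.2.1)⁻¹ := by
    rw [ringInverse_apply hS]
    simp [denS, stiffness, tanhB_apply]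
    ring
  simp only [defectB, riccatiDefect, potentialPoly, dampingPoly, potentialCorr,
    BoundedContinuousFunction.coe_add, BoundedContinuousFunction.coe_sub,
    BoundedContinuousFunction.coe_mul, BoundedContinuousFunction.coe_pow, Pi.add_apply,
    Pi.sub_apply, Pi.mul_apply, Pi.pow_apply, BoundedContinuousFunction.coe_smul,
    BoundedContinuousFunction.coe_one, Pi.one_apply, eP, eQ, eS, tanhB_apply, zBaseB_apply,
    two, four, eight, smul_eq_mul, mul_one, potential, damping, quadCoeff, stiffness]

theorem defectB_base : defectB baseParam = 0 := by
  ext y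
  rw [eventually_defectB_apply.self_of_nhds y]
  simp [baseParam, potential, damping, quadCoeff, potentialPoly, dampingPoly, stiffness,
    zBaseB_apply]
  ring

/-- The derivative of `t ↦ t e s(t)` at `0`. -/
theorem hasDerivAt_mul_zero {s : ℝ → ℝ} (e : ℝ) (hs : ContinuousAt s 0) :
    HasDerivAt (fun t => t * e * s t) (e * s 0) 0 := by
  rw [hasDerivAt_iff_tendsto_slope]
  have h : Tendsto (fun t => e * s t) (𝓝[≠] 0) (𝓝 (e * s 0)) :=
    (hs.tendsto.const_mul e).mono_left nhdsWithin_le_nhds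
  refine h.congr' ?_
  filter_upwards [self_mem_nhdsWithin] with t ht
  simp only [slope_def_field, zero_mul, sub_zero]
  field_simp [show t ≠ 0 from ht]

/-- Restriction to a line and evaluation at `y` reduce this to one-variable calculus. The direction
`ζ` drops out because the term `2 Z₀ Z` cancels the derivative of `-Z²`. -/
theorem fderiv_defectB_apply (e l : ℝ) (ζ : ℝ →ᵇ ℝ) :
    fderiv ℝ defectB baseParam (e, l, ζ) = e • firstDefectB + l • 1 := by
  ext y
  have hd : HasFDerivAt defectB (fderiv ℝ defectB baseParam) baseParam :=
    (contDiffAt_defectB.differentiableAt (by norm_num)).hasFDerivAt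
  have hline : HasDerivAt (fun t : ℝ => baseParam + t • ((e, l, ζ) : Param)) (e, l, ζ) 0 := by
    simpa using ((hasDerivAt_id (0 : ℝ)).smul_const ((e, l, ζ) : Param)).const_add baseParam
  have h1 : HasDerivAt (fun t : ℝ => defectB (baseParam + t • ((e, l, ζ) : Param)))
      (fderiv ℝ defectB baseParam (e, l, ζ)) 0 := by
    refine HasFDerivAt.comp_hasDerivAt (l := defectB) 0 ?_ hline
    simpa using hd
  have h2 := ((BoundedContinuousFunction.evalCLM ℝ y).hasFDerivAt).comp_hasDerivAt 0 h1
  set T := Real.tanh y with hT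
  set z := zBase T with hz
  have hs : ∀ c : ℝ, HasDerivAt (fun t : ℝ => c + t * l) l 0 := fun c => by
    simpa using ((hasDerivAt_id (0 : ℝ)).mul_const l).const_add c
  have hP : HasDerivAt (fun t : ℝ => stiffness (t * e) T) (e * (4 * T ^ 2 - 2)) 0 := by
    have h := (hasDerivAt_mul_zero e (s := fun _ => 4 * T ^ 2 - 2) continuousAt_const).const_add 1
    refine h.congr_of_eventuallyEq (Eventually.of_forall fun t => ?_)
    simp only [stiffness]; ring
  have hQ : HasDerivAt (fun t : ℝ => 1 + t * e * T ^ 2) (e * T ^ 2) 0 :=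
    (hasDerivAt_mul_zero e (s := fun _ => T ^ 2) continuousAt_const).const_add 1
  have hS : HasDerivAt (fun t : ℝ => stiffness (t * e) T + 2 * (t * e) * (lam₀ + t * l))
      (e * (4 * T ^ 2 - 2) + e * (2 * lam₀)) 0 := by
    have h := hP.add (hasDerivAt_mul_zero e (s := fun t => 2 * (lam₀ + t * l)) (by fun_prop))
    simp only [zero_mul, add_zero] at h
    refine h.congr_of_eventuallyEq (Eventually.of_forall fun t => ?_)
    simp only [Pi.add_apply]; ring
  have hP0 : stiffness (0 * e) T = 1 := by simp [stiffness]
  have cP : ContinuousAt (fun t : ℝ => (stiffness (t * e) T)⁻¹) 0 :=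
    hP.continuousAt.inv₀ (by rw [hP0]; exact one_ne_zero)
  have cQ : ContinuousAt (fun t : ℝ => (1 + t * e * T ^ 2)⁻¹) 0 :=
    hQ.continuousAt.inv₀ (by simp)
  have hV : HasDerivAt (fun t : ℝ => potential (t * e) (lam₀ + t * l) T)
      (e * (-3 + 12 * T ^ 2 - 8 * T ^ 4 + lam₀ * (4 * T ^ 2 - 2) + lam₀ ^ 2) + l) 0 := by
    -- The correction carries the factor `t * e`, so only its value at `t = 0` enters and its
    -- inverses need not be differentiated.
    have h := (((hasDerivAt_mul_zero e
      (s := fun t => potentialCorr (t * e) T (stiffness (t * e) T)⁻¹)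
      (by unfold potentialCorr; fun_prop)).const_sub (2 * T ^ 2 - 1)).add ((hs lam₀).mul hP)).add
      (hasDerivAt_mul_zero e (s := fun t => (lam₀ + t * l) ^ 2) (by fun_prop))
    refine h.congr_deriv ?_
    simp [potentialCorr, stiffness]
    ring
  have hb : HasDerivAt (fun t : ℝ => damping (t * e) T) (e * ((1 - T ^ 2) * (-3 * T))) 0 := by
    have h := hasDerivAt_mul_zero e
      (s := fun t => (1 - T ^ 2) * (T * (1 + t * e * T ^ 2)⁻¹ - 4 * T * (stiffness (t * e) T)⁻¹))
      (by fun_prop)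
    refine h.congr_deriv ?_
    simp [stiffness]
    ring
  have hg : HasDerivAt (fun t : ℝ => quadCoeff (t * e) (lam₀ + t * l) T)
      (-(e * (T ^ 2 + 2 * lam₀))) 0 := by
    have h := (hP.mul (hQ.inv (by simp))).mul (hS.inv (by simp [stiffness]))
    refine h.congr_deriv ?_
    simp [stiffness]
    ring
  have hZ : HasDerivAt (fun t : ℝ => z + t * ζ y) (ζ y) 0 := by
    simpa using ((hasDerivAt_id (0 : ℝ)).mul_const (ζ y)).const_add z
  have h3 := (((((hV.sub_const (2 * T ^ 2 - 1 + lam₀)).add (hb.mul hZ)).sub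
    (hg.mul (hZ.pow 2))).add (hZ.const_mul (2 * z))).sub_const (z ^ 2))
  have hev : (fun t : ℝ => defectB (baseParam + t • ((e, l, ζ) : Param)) y) =ᶠ[𝓝 0]
      (fun t : ℝ => potential (t * e) (lam₀ + t * l) T - (2 * T ^ 2 - 1 + lam₀)
        + damping (t * e) T * (z + t * ζ y)
        - quadCoeff (t * e) (lam₀ + t * l) T * (z + t * ζ y) ^ 2
        + 2 * z * (z + t * ζ y) - z ^ 2) := by
    have hc : Tendsto (fun t : ℝ => baseParam + t • ((e, l, ζ) : Param)) (𝓝 0) (𝓝 baseParam) := by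
      simpa using hline.continuousAt.tendsto
    filter_upwards [hc.eventually eventually_defectB_apply] with t ht
    have e1 : (baseParam + t • ((e, l, ζ) : Param)).1 = t * e := by simp [baseParam]
    have e2 : (baseParam + t • ((e, l, ζ) : Param)).2.1 = lam₀ + t * l := by simp [baseParam]
    have e3 : (baseParam + t • ((e, l, ζ) : Param)).2.2 y = z + t * ζ y := by
      simp [baseParam, zBaseB_apply, hz, hT]
    rw [ht y, e1, e2, e3]
  have h6 := h2.unique (h3.congr_of_eventuallyEq hev)
  simp only [BoundedContinuousFunction.evalCLM_apply] at h6
  rw [h6]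
  simp [firstDefectB_apply, firstDefect, damping, dampingPoly, quadCoeff, stiffness, ← hT, ← hz]
  ring

/-! ### The branch of eigenvalues -/

/-- The Riccati equation with the boundary condition at `y₀`, in integrated form. -/
def branchMap (p : Param) : ℝ × (ℝ →ᵇ ℝ) :=
  (BoundedContinuousFunction.evalCLM ℝ y₀ p.2.2,
    p.2.2 - zBaseB - decayWeight_wBase.op (defectB p))

theorem contDiffAt_branchMap : ContDiffAt ℝ 2 branchMap baseParam := by
  have := contDiffAt_defectB
  unfold branchMap
  fun_prop

theorem branchMap_base : branchMap baseParam = 0 := by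
  rw [branchMap, defectB_base]
  simp [baseParam, zBaseB_apply, zBase_y₀]

theorem fderiv_branchMap_apply (e l : ℝ) (ζ : ℝ →ᵇ ℝ) :
    fderiv ℝ branchMap baseParam (e, l, ζ)
      = (ζ y₀, ζ - decayWeight_wBase.op (e • firstDefectB + l • 1)) := by
  have hd : HasFDerivAt defectB (fderiv ℝ defectB baseParam) baseParam :=
    (contDiffAt_defectB.differentiableAt (by norm_num)).hasFDerivAt
  have h2 : HasFDerivAt (fun p : Param => p.2.2)
      ((ContinuousLinearMap.snd ℝ ℝ (ℝ →ᵇ ℝ)).comp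
        (ContinuousLinearMap.snd ℝ ℝ (ℝ × (ℝ →ᵇ ℝ)))) baseParam :=
    ((ContinuousLinearMap.snd ℝ ℝ (ℝ →ᵇ ℝ)).comp
      (ContinuousLinearMap.snd ℝ ℝ (ℝ × (ℝ →ᵇ ℝ)))).hasFDerivAt
  have h := (((BoundedContinuousFunction.evalCLM ℝ y₀).hasFDerivAt).comp baseParam h2).prodMk
    ((h2.sub_const zBaseB).sub ((decayWeight_wBase.op.hasFDerivAt).comp baseParam hd))
  have h' : HasFDerivAt branchMap _ baseParam := h
  rw [h'.fderiv]
  have e1 := fderiv_defectB_apply e l ζ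
  simp only [ContinuousLinearMap.prod_apply, sub_apply, ContinuousLinearMap.comp_apply]
  rw [e1]
  rfl

abbrev partialMap : ℝ × (ℝ →ᵇ ℝ) →L[ℝ] ℝ × (ℝ →ᵇ ℝ) :=
  fderiv ℝ branchMap baseParam ∘L .inr ℝ ℝ (ℝ × (ℝ →ᵇ ℝ))

theorem partialMap_apply (l : ℝ) (ζ : ℝ →ᵇ ℝ) :
    partialMap (l, ζ) = (ζ y₀, ζ - l • decayWeight_wBase.op 1) := by
  simp [partialMap, fderiv_branchMap_apply]

/-- Given `m = ζ y₀` and `h = ζ - l • u` with `u = op 1`, evaluation at `y₀` recovers `l = (m - h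
y₀) / u y₀`, and then `ζ = h + l • u`. -/
theorem partialMap_isInvertible : partialMap.IsInvertible := by
  have h1 := (decayWeight_wBase.op_one_pos y₀).ne'
  set u := decayWeight_wBase.op 1 with hu
  let c : ℝ × (ℝ →ᵇ ℝ) →L[ℝ] ℝ := (u y₀)⁻¹ • (ContinuousLinearMap.fst ℝ ℝ (ℝ →ᵇ ℝ)
    - (BoundedContinuousFunction.evalCLM ℝ y₀).comp (ContinuousLinearMap.snd ℝ ℝ (ℝ →ᵇ ℝ)))
  let g : ℝ × (ℝ →ᵇ ℝ) →L[ℝ] ℝ × (ℝ →ᵇ ℝ) :=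
    c.prod (ContinuousLinearMap.snd ℝ ℝ (ℝ →ᵇ ℝ) + c.smulRight u)
  have hc : ∀ m h, c (m, h) = (u y₀)⁻¹ * (m - h y₀) := fun m h => by simp [c]
  refine ⟨ContinuousLinearEquiv.equivOfInverse partialMap g ?_ ?_, rfl⟩
  · rintro ⟨l, ζ⟩
    rw [partialMap_apply]
    have : c (ζ y₀, ζ - l • u) = l := by
      rw [hc]; simp; field_simp
    simp [g, ← hu, this]
  · rintro ⟨m, h⟩
    have : g (m, h) = (c (m, h), h + c (m, h) • u) := by simp [g]
    rw [this, partialMap_apply, ← hu, hc]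
    ext
    · simp; field_simp; ring
    · simp

/-- The explicit correction is bounded, so `DecayWeight.eq_op` identifies it with the weighted
primitive; implicit differentiation then gives the derivative of the branch. -/
theorem partialMap_firstCorr :
    partialMap (slope, firstCorrB) = (0, decayWeight_wBase.op firstDefectB) := by
  have h : firstCorrB = decayWeight_wBase.op (firstDefectB + slope • 1) := by
    refine decayWeight_wBase.eq_op hasDerivAt_wBase tendsto_wBase fun y => ?_
    have h := hasDerivAt_firstCorr y
    have e : ⇑firstCorrB = fun y => firstCorr (Real.tanh y) := funext firstCorrB_apply
    rw [e]
    refine h.congr_deriv ?_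
    simp [firstDefectB_apply]
  rw [partialMap_apply, firstCorrB_apply, firstCorr_y₀]
  congr 1
  conv_lhs => rw [h]
  simp

def branch : ℝ → ℝ × (ℝ →ᵇ ℝ) :=
  contDiffAt_branchMap.implicitFunction (by norm_num) partialMap_isInvertible

theorem branch_zero : branch 0 = (lam₀, zBaseB) :=
  contDiffAt_branchMap.implicitFunction_apply_self (by norm_num) partialMap_isInvertible

theorem contDiffAt_branch : ContDiffAt ℝ 2 branch 0 :=
  contDiffAt_branchMap.contDiffAt_implicitFunction (by norm_num) partialMap_isInvertible

theorem hasDerivAt_branch : HasDerivAt branch (slope, firstCorrB) 0 := by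
  have h := (contDiffAt_branchMap.hasStrictFDerivAt_implicitFunction (by norm_num)
    partialMap_isInvertible).hasFDerivAt.hasDerivAt
  refine HasDerivAt.congr_deriv (f := branch) h ?_
  have e : fderiv ℝ branchMap baseParam (1, 0) = - partialMap (slope, firstCorrB) := by
    rw [partialMap_firstCorr]
    have := fderiv_branchMap_apply 1 0 0
    rw [show ((0 : ℝ), (0 : ℝ →ᵇ ℝ)) = 0 from rfl] at this
    rw [this]
    simp
  obtain ⟨E, hE⟩ := partialMap_isInvertible
  simp only [ContinuousLinearMap.comp_apply, ContinuousLinearMap.inl_apply,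
    neg_apply]
  rw [e]
  change -(partialMap.inverse _) = _
  rw [map_neg, neg_neg, ← hE, ContinuousLinearMap.inverse_equiv]
  exact E.symm_apply_apply _

theorem eventually_branchMap : ∀ᶠ e in 𝓝 (0 : ℝ), branchMap (e, branch e) = 0 := by
  rw [← branchMap_base]
  exact contDiffAt_branchMap.eventually_apply_implicitFunction (by norm_num)
    partialMap_isInvertible

/-- Differentiating `Z = zBase + op (defectB (e, Λ, Z))` turns the integrated equation back into the
differential one. -/
theorem eventually_riccati : ∀ᶠ e in 𝓝 (0 : ℝ), (branch e).2 y₀ = 0 ∧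
    ∀ y, HasDerivAt (branch e).2 (potential e (branch e).1 (Real.tanh y)
      + damping e (Real.tanh y) * (branch e).2 y
      - quadCoeff e (branch e).1 (Real.tanh y) * (branch e).2 y ^ 2) y := by
  have hc : Tendsto (fun e => (e, branch e)) (𝓝 0) (𝓝 baseParam) := by
    have h := (continuousAt_id (x := (0 : ℝ))).prodMk contDiffAt_branch.continuousAt
    have h' : Tendsto (fun e => (e, branch e)) (𝓝 0) (𝓝 ((0 : ℝ), branch 0)) := h
    rwa [branch_zero] at h'
  filter_upwards [eventually_branchMap, hc.eventually eventually_defectB_apply] with e h1 h2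
  rw [branchMap, Prod.mk_eq_zero] at h1
  refine ⟨h1.1, fun y => ?_⟩
  have h3 : (branch e).2 = zBaseB + decayWeight_wBase.op (defectB (e, branch e)) := by
    have := h1.2
    rw [sub_sub, sub_eq_zero] at this
    exact this
  have h4 : ∀ y, (branch e).2 y
      = zBase (Real.tanh y) + decayWeight_wBase.op (defectB (e, branch e)) y := fun y => by
    conv_lhs => rw [h3]
    rw [BoundedContinuousFunction.coe_add, Pi.add_apply, zBaseB_apply]
  have h5 := (hasDerivAt_zBase y).add
    (decayWeight_wBase.hasDerivAt_op hasDerivAt_wBase (defectB (e, branch e)) y)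
  have h6 : HasDerivAt (branch e).2 _ y :=
    h5.congr_of_eventuallyEq (Eventually.of_forall h4)
  refine h6.congr_deriv ?_
  rw [h2 y]
  have h7 : decayWeight_wBase.op (defectB (e, branch e)) y
      = (branch e).2 y - zBase (Real.tanh y) := by rw [h4 y]; ring
  rw [h7]
  ring

/-- The derivative is C¹, hence Lipschitz near `0`, so it differs from `f'` by at most `K |x|` on
the ball of radius `|x|`; the mean value inequality concludes. -/
theorem exists_taylor_bound {f : ℝ → ℝ} {f' : ℝ} (hf : ContDiffAt ℝ 2 f 0)
    (hd : HasDerivAt f f' 0) :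
    ∃ K : ℝ, ∀ᶠ x in 𝓝 (0 : ℝ), |f x - (f 0 + f' * x)| ≤ K * x ^ 2 := by
  have hd' : ContDiffAt ℝ 1 (deriv f) 0 := by
    have h : ContDiffAt ℝ 1 (fderiv ℝ f) 0 := hf.fderiv_right (by norm_num)
    exact h.clm_apply contDiffAt_const
  obtain ⟨K, s, hs, hK⟩ := hd'.exists_lipschitzOnWith
  have hev : ∀ᶠ x in 𝓝 (0 : ℝ), DifferentiableAt ℝ f x :=
    (hf.eventually (by simp)).mono fun x hx => hx.differentiableAt (by norm_num)
  obtain ⟨r, hr, hball⟩ := Metric.eventually_nhds_iff_ball.1 (hev.and hs)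
  refine ⟨K, ?_⟩
  filter_upwards [Metric.ball_mem_nhds 0 hr] with x hx
  have hx' : |x| < r := by simpa using hx
  have hsub : ∀ y ∈ Metric.closedBall (0 : ℝ) |x|, y ∈ Metric.ball (0 : ℝ) r := fun y hy => by
    have : |y| ≤ |x| := by simpa using hy
    simpa using lt_of_le_of_lt this hx'
  have h := (convex_closedBall (0 : ℝ) |x|).norm_image_sub_le_of_norm_hasDerivWithin_le
    (f := fun y => f y - f' * y) (f' := fun y => deriv f y - f') (C := K * |x|)
    (x := 0) (y := x)
    (fun y hy => by
      have := ((hball y (hsub y hy)).1.hasDerivAt.sub ((hasDerivAt_id y).const_mul f'))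
      rw [mul_one] at this
      exact this.hasDerivWithinAt)
    (fun y hy => by
      have h1 := hK.dist_le_mul y (hball y (hsub y hy)).2 0 (hball 0 (by simpa using hr)).2
      rw [hd.deriv, Real.dist_eq, Real.dist_eq, sub_zero] at h1
      have : |y| ≤ |x| := by simpa using hy
      exact h1.trans (mul_le_mul_of_nonneg_left this K.2))
    (by simp) (by simp)
  simp only [Real.norm_eq_abs, mul_zero, sub_zero] at h
  calc |f x - (f 0 + f' * x)| = |f x - f' * x - f 0| := by congr 1; ring
    _ ≤ K * |x| * |x| := h
    _ = K * x ^ 2 := by rw [mul_assoc, abs_mul_abs_self]; ring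

/-- Strict differentiability compares any two points near `0`: the error is at most half of the
linear term. -/
theorem exists_strictMonoOn {f : ℝ → ℝ} {f' : ℝ} (hd : HasStrictDerivAt f f' 0) (hf' : 0 < f') :
    ∃ r > 0, StrictMonoOn f (Metric.ball 0 r) := by
  have h := hd.isLittleO.def (half_pos hf')
  rw [nhds_prod_eq] at h
  obtain ⟨s, hs, h2⟩ := (Filter.eventually_prod_self_iff (r := fun x y =>
    ‖f x - f y - (ContinuousLinearMap.toSpanSingleton ℝ f') (x - y)‖ ≤ f' / 2 * ‖x - y‖)).1 h
  obtain ⟨r, hr, hball⟩ := Metric.mem_nhds_iff.1 hs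
  refine ⟨r, hr, fun x hx y hy hxy => ?_⟩
  have h3 := h2 y (hball hy) x (hball hx)
  have h4 := (abs_le.1 h3).1
  simp only [ContinuousLinearMap.toSpanSingleton_apply, smul_eq_mul] at h4
  rw [Real.norm_eq_abs, abs_of_pos (sub_pos.2 hxy)] at h4
  nlinarith [mul_pos (sub_pos.2 hxy) hf']

/-- A perturbation of size less than `1/2` then leaves the solution at least `1/2` near `y = -∞`,
which makes the eigenfunction decay. -/
theorem zBase_ge {T : ℝ} (hT : T ≤ -9 / 10) : 1 ≤ zBase T := by
  have hm := mu_bounds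
  have : (1 - T ^ 2) / (mu - T) ≤ 1 / 10 := by
    rw [div_le_iff₀ (by linarith)]
    nlinarith
  rw [zBase]
  linarith

theorem slope_pos : 0 < slope := by unfold slope; positivity

/-- The branch of eigenvalues of the kinks, with the solution of the Riccati equation which gives
the eigenfunction. -/
theorem exists_branch : ∃ e₀ > 0, ∃ K : ℝ, ∃ L : ℝ → ℝ, StrictMonoOn L (Ico 0 e₀) ∧
    ∀ e ∈ Ico 0 e₀, |L e - (lam₀ + slope * e)| ≤ K * e ^ 2 ∧ 0.2 ≤ L e ∧ L e ≤ 0.4 ∧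
      ∃ Z : ℝ → ℝ, Z y₀ = 0 ∧ (∀ y, HasDerivAt Z (potential e (L e) (Real.tanh y)
        + damping e (Real.tanh y) * Z y - quadCoeff e (L e) (Real.tanh y) * Z y ^ 2) y) ∧
        (∃ M, ∀ y, |Z y| ≤ M) ∧ ∀ y, Real.tanh y ≤ -9 / 10 → 1 / 2 ≤ Z y := by
  have hL : ContDiffAt ℝ 2 (fun e => (branch e).1) 0 := contDiffAt_branch.fst
  have hLd : HasDerivAt (fun e => (branch e).1) slope 0 := hasDerivAt_branch.fst
  have hL0 : (branch 0).1 = lam₀ := by rw [branch_zero]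
  obtain ⟨K, hK⟩ := exists_taylor_bound hL hLd
  have hstrict : HasStrictDerivAt (fun e => (branch e).1) slope 0 := by
    have := hL.hasStrictDerivAt (by norm_num)
    rwa [hLd.deriv] at this
  obtain ⟨r, hr, hmono⟩ := exists_strictMonoOn hstrict slope_pos
  have hval : ∀ᶠ e in 𝓝 (0 : ℝ), 0.2 < (branch e).1 ∧ (branch e).1 < 0.4 := by
    have h := hL.continuousAt
    have hb := lam₀_bounds
    refine (h.eventually_const_lt ?_).and (h.eventually_lt_const ?_) <;> simp only [hL0] <;> linarith
  have hZ : ∀ᶠ e in 𝓝 (0 : ℝ), dist (branch e).2 zBaseB < 1 / 2 := by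
    have h : ContinuousAt (fun e => (branch e).2) 0 := contDiffAt_branch.continuousAt.snd
    have := h.eventually (Metric.ball_mem_nhds _ (show (0 : ℝ) < 1 / 2 by norm_num))
    simp only [branch_zero] at this
    exact this
  obtain ⟨s, hs, hball⟩ := Metric.eventually_nhds_iff_ball.1
    (((hK.and hval).and hZ).and eventually_riccati)
  have hin : ∀ e ∈ Ico 0 (min r s), e ∈ Metric.ball (0 : ℝ) r ∧ e ∈ Metric.ball (0 : ℝ) s :=
    fun e he => by
      simp only [Metric.mem_ball, Real.dist_eq, sub_zero, abs_of_nonneg he.1]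
      exact lt_min_iff.1 he.2
  refine ⟨min r s, lt_min hr hs, K, fun e => (branch e).1,
    hmono.mono fun e he => (hin e he).1, fun e he => ?_⟩
  obtain ⟨⟨⟨h1, h2⟩, h3⟩, h4, h5⟩ := hball e (hin e he).2
  rw [hL0] at h1
  refine ⟨h1, h2.1.le, h2.2.le, (branch e).2, h4, h5,
    ⟨‖(branch e).2‖, fun y => (branch e).2.norm_coe_le_norm y⟩, fun y hy => ?_⟩
  have h6 := (BoundedContinuousFunction.dist_coe_le_dist (f := (branch e).2) (g := zBaseB) y).trans
    h3.le
  rw [zBaseB_apply, Real.dist_eq] at h6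
  have h7 := zBase_ge hy
  linarith [(abs_le.1 h6).1]

/-! ### The shape of a `3π`-kink -/

theorem lt_or_gt_of_ne_on_Iic {f : ℝ → ℝ} (hf : ContinuousOn f (Iic 0)) {c : ℝ}
    (hc : ∀ x ≤ 0, f x ≠ c) : (∀ x ≤ 0, f x < c) ∨ ∀ x ≤ 0, c < f x := by
  by_contra! h
  obtain ⟨⟨x, hx, hx'⟩, y, hy, hy'⟩ := h
  obtain ⟨z, hz, hz'⟩ := isPreconnected_Iic.intermediate_value hy hx hf ⟨hy', hx'⟩
  exact hc z hz hz'

namespace IsThreePiKink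

variable {a : ℝ} {φ : ℝ → ℝ}

theorem deriv_reflect (φ : ℝ → ℝ) :
    deriv (fun x => 3 * Real.pi - φ (-x)) = fun x => deriv φ (-x) := by
  funext x
  rw [deriv_const_sub, deriv_comp_neg, neg_neg]

theorem deriv_deriv_reflect (φ : ℝ → ℝ) :
    deriv (deriv (fun x => 3 * Real.pi - φ (-x))) = fun x => -deriv (deriv φ) (-x) := by
  funext x
  rw [deriv_reflect, deriv_comp_neg]

theorem sin_reflect (u : ℝ) {x : ℝ} (hx : x ≠ 0) :
    Real.sin (3 * Real.pi - u + theta x) = -Real.sin (u + theta (-x)) := by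
  rcases lt_or_gt_of_ne hx with h | h
  · have h2 : 0 < -x := by linarith
    rw [theta, theta, if_neg h.not_gt, if_pos h2, add_zero, ← sub_eq_add_neg, Real.sin_sub_pi,
      show 3 * Real.pi - u = Real.pi - u + 2 * Real.pi by ring, Real.sin_add_two_pi,
      Real.sin_pi_sub, neg_neg]
  · have h2 : ¬ 0 < -x := by linarith
    rw [theta, theta, if_pos h, if_neg h2, add_zero,
      show 3 * Real.pi - u + -Real.pi = 2 * Real.pi - u by ring, Real.sin_two_pi_sub]

theorem cos_reflect (u : ℝ) {x : ℝ} (hx : x ≠ 0) :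
    Real.cos (3 * Real.pi - u + theta x) = Real.cos (u + theta (-x)) := by
  rcases lt_or_gt_of_ne hx with h | h
  · have h2 : 0 < -x := by linarith
    rw [theta, theta, if_neg h.not_gt, if_pos h2, add_zero, ← sub_eq_add_neg, Real.cos_sub_pi,
      show 3 * Real.pi - u = Real.pi - u + 2 * Real.pi by ring, Real.cos_add_two_pi,
      Real.cos_pi_sub]
  · have h2 : ¬ 0 < -x := by linarith
    rw [theta, theta, if_pos h, if_neg h2, add_zero,
      show 3 * Real.pi - u + -Real.pi = 2 * Real.pi - u by ring, Real.cos_two_pi_sub]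

/-- The reflection `x ↦ 3π - φ(-x)` maps kinks to kinks. -/
theorem reflect (h : IsThreePiKink a φ) : IsThreePiKink a fun x => 3 * Real.pi - φ (-x) where
  differentiable := (h.differentiable.comp differentiable_neg).const_sub _
  continuous_deriv := by
    rw [deriv_reflect]; exact h.continuous_deriv.comp continuous_neg
  differentiable_deriv := fun x hx => by
    rw [deriv_reflect]
    exact (h.differentiable_deriv (-x) (neg_ne_zero.2 hx)).comp x differentiable_neg.differentiableAt
  static := fun x hx => by
    have := h.static (-x) (neg_ne_zero.2 hx)
    rw [deriv_deriv_reflect, deriv_reflect]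
    rw [staticResidual] at this ⊢
    rw [sin_reflect _ hx, cos_reflect _ hx]
    linear_combination -this
  memLp_deriv := by
    rw [deriv_reflect]
    exact h.memLp_deriv.comp_measurePreserving (Measure.measurePreserving_neg volume)
  memLp_deriv_deriv := by
    rw [deriv_deriv_reflect]
    exact (h.memLp_deriv_deriv.comp_measurePreserving (Measure.measurePreserving_neg volume)).neg
  tendsto_atBot := by
    have := (h.tendsto_atTop.comp tendsto_neg_atBot_atTop).const_sub (3 * Real.pi)
    simpa using this
  tendsto_atTop := by
    have := (h.tendsto_atBot.comp tendsto_neg_atTop_atBot).const_sub (3 * Real.pi)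
    simpa using this

/-! ### The first integral and the value at the junction -/

theorem static_left (h : IsThreePiKink a φ) {x : ℝ} (hx : x < 0) :
    deriv (deriv φ) x * (1 + 2 * (a ^ 2 / 12) * Real.cos (φ x))
      = Real.sin (φ x) * (1 + a ^ 2 / 12 * deriv φ x ^ 2 + a ^ 2 / 12 * Real.cos (φ x)) := by
  have := h.static x hx.ne
  rw [staticResidual, theta, if_neg hx.not_gt, add_zero] at this
  linear_combination this

/-- The first integral, with the constant determined by the limit at `-∞`. -/
theorem first_integral (h : IsThreePiKink a φ) (ha : a ^ 2 / 12 ≤ 1 / 100) {x : ℝ} (hx : x ≤ 0) :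
    (1 + 2 * (a ^ 2 / 12) * Real.cos (φ x)) * deriv φ x ^ 2
      = (1 - Real.cos (φ x)) * (2 + a ^ 2 / 12 * (1 + Real.cos (φ x))) := by
  have he0 : 0 ≤ a ^ 2 / 12 := by positivity
  set e := a ^ 2 / 12 with he
  let E : ℝ → ℝ := fun x => (1 + 2 * e * Real.cos (φ x)) * deriv φ x ^ 2
    - (1 - Real.cos (φ x)) * (2 + e * (1 + Real.cos (φ x)))
  have hEc : Continuous E := by
    have h1 := h.differentiable.continuous
    have h2 := h.continuous_deriv
    fun_prop
  have hE : ∀ x < 0, HasDerivAt E 0 x := fun x hx => by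
    have h1 := (h.differentiable x).hasDerivAt.cos
    have h2 := (h.differentiable_deriv x hx.ne).hasDerivAt
    have h3 := (((h1.const_mul (2 * e)).const_add 1).mul (h2.pow 2)).sub
      ((h1.const_sub 1).mul ((((h1.const_add 1)).const_mul e).const_add 2))
    refine HasDerivAt.congr_deriv (f := E) h3 ?_
    have := h.static_left hx
    rw [← he] at this
    simp only [Pi.pow_apply]
    push_cast
    linear_combination 2 * deriv φ x * this
  obtain ⟨c, hc⟩ := isOpen_Iio.exists_is_const_of_deriv_eq_zero (s := Iio (0 : ℝ)) isPreconnected_Iio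
    (fun x hx => (hE x hx).differentiableAt.differentiableWithinAt) (fun x hx => (hE x hx).deriv)
  have hc0 : c = 0 := by
    have hcos : Tendsto (fun x => Real.cos (φ x)) atBot (𝓝 1) := by
      have := (Real.continuous_cos.tendsto 0).comp h.tendsto_atBot
      rwa [Real.cos_zero] at this
    have hden : Tendsto (fun x => 1 + 2 * e * Real.cos (φ x)) atBot (𝓝 (1 + 2 * e * 1)) :=
      (hcos.const_mul (2 * e)).const_add 1
    have hlim : Tendsto (fun x => (c + (1 - Real.cos (φ x)) * (2 + e * (1 + Real.cos (φ x))))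
        / (1 + 2 * e * Real.cos (φ x))) atBot (𝓝 ((c + (1 - 1) * (2 + e * (1 + 1))) / (1 + 2 * e * 1))) :=
      ((((hcos.const_sub 1).mul (((hcos.const_add 1).const_mul e).const_add 2))).const_add c).div hden
        (by positivity)
    have hlim' : Tendsto (fun x => deriv φ x ^ 2) atBot
        (𝓝 ((c + (1 - 1) * (2 + e * (1 + 1))) / (1 + 2 * e * 1))) := by
      refine hlim.congr' ?_
      filter_upwards [eventually_lt_atBot 0] with x hx
      have h1 := hc x hx
      have h2 : 0 < 1 + 2 * e * Real.cos (φ x) := by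
        nlinarith [Real.neg_one_le_cos (φ x), Real.cos_le_one (φ x)]
      rw [div_eq_iff h2.ne']
      simp only [E] at h1
      linear_combination -h1
    -- An integrable function with a limit at `-∞` has limit `0` there, which forces `c = 0`.
    have hint : Integrable (fun x => deriv φ x ^ 2) := h.memLp_deriv.integrable_sq
    have h0 := (hint.integrableAtFilter atBot).eq_zero_of_tendsto
      (fun s hs => by
        obtain ⟨b, hb⟩ := mem_atBot_sets.1 hs
        exact top_le_iff.1 ((Real.volume_Iic (a := b)).symm.le.trans (measure_mono hb))) hlim'
    rw [sub_self, zero_mul, add_zero, div_eq_zero_iff] at h0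
    exact h0.resolve_right (by positivity)
  have hcl : ∀ x ∈ closure (Iio (0 : ℝ)), E x = 0 :=
    closure_minimal (fun x hx => (hc x hx).trans hc0) (isClosed_eq hEc continuous_const)
  have := hcl x (by rwa [closure_Iio])
  simp only [E] at this
  linear_combination this

/-- Reflection keeps `φ_x(0)` and changes the sign of `c = cos φ(0)`. Eliminating `φ_x(0)²` from the
two first integrals leaves `c` times a positive factor. -/
theorem cos_zero (h : IsThreePiKink a φ) (ha : a ^ 2 / 12 ≤ 1 / 100) : Real.cos (φ 0) = 0 := by
  have h1 := h.first_integral ha le_rfl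
  have h2 := h.reflect.first_integral ha le_rfl
  have e1 : Real.cos (3 * Real.pi - φ 0) = -Real.cos (φ 0) := by
    rw [show 3 * Real.pi - φ 0 = Real.pi - φ 0 + 2 * Real.pi by ring, Real.cos_add_two_pi,
      Real.cos_pi_sub]
  rw [deriv_reflect] at h2
  simp only [neg_zero, e1] at h2
  have he0 : 0 ≤ a ^ 2 / 12 := by positivity
  set e := a ^ 2 / 12
  set c := Real.cos (φ 0)
  have hc : c ^ 2 ≤ 1 := by
    have := Real.cos_sq_add_sin_sq (φ 0)
    nlinarith [sq_nonneg (Real.sin (φ 0))]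
  have h3 : c * (1 + 2 * e + e ^ 2 * (1 - c ^ 2)) = 0 := by
    linear_combination ((1 - 2 * e * c) * h1 - (1 + 2 * e * c) * h2) / 4
  refine (mul_eq_zero.1 h3).resolve_right ?_
  have : 0 ≤ e ^ 2 * (1 - c ^ 2) := mul_nonneg (sq_nonneg _) (by linarith)
  positivity

/-- On the left half line a kink never takes an equilibrium value. -/
theorem ne_equilibrium (h : IsThreePiKink a φ) (ha : a ^ 2 / 12 ≤ 1 / 100) (k : ℤ) {x : ℝ}
    (hx : x ≤ 0) : φ x ≠ k * (2 * Real.pi) := by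
  intro hk
  have he0 : 0 ≤ a ^ 2 / 12 := by positivity
  set e := a ^ 2 / 12 with he
  let g : ℝ → ℝ := fun x => (φ x - k * (2 * Real.pi)) ^ 2
  have hg : ∀ x, HasDerivAt g (2 * (φ x - k * (2 * Real.pi)) * deriv φ x) x := fun x => by
    have := ((h.differentiable x).hasDerivAt.sub_const (k * (2 * Real.pi))).pow 2
    refine HasDerivAt.congr_deriv (f := g) this ?_
    push_cast; ring
  -- A Grönwall argument: the first integral gives `|φ_x| ≤ 2 |φ - 2πk|`, so `g exp (4x)` increases,
  -- `g exp (-4x)` decreases, and one zero of `g` spreads over the half line, contradicting `cos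
  -- φ(0) = 0`.
  have hb : ∀ x ≤ 0, |2 * (φ x - k * (2 * Real.pi)) * deriv φ x| ≤ 4 * g x := fun x hx => by
    have h1 := h.first_integral ha hx
    rw [← he] at h1
    have h2 := Real.one_sub_sq_div_two_le_cos (x := φ x - k * (2 * Real.pi))
    rw [Real.cos_sub_int_mul_two_pi] at h2
    have h3 := Real.neg_one_le_cos (φ x)
    have h4 := Real.cos_le_one (φ x)
    set d := φ x - k * (2 * Real.pi)
    set c := Real.cos (φ x)
    have h5 : deriv φ x ^ 2 ≤ (2 * d) ^ 2 := by
      have h6 : (1 / 2) * deriv φ x ^ 2 ≤ (1 + 2 * e * c) * deriv φ x ^ 2 :=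
        mul_le_mul_of_nonneg_right (by nlinarith) (sq_nonneg _)
      have h7 : (1 - c) * (2 + e * (1 + c)) ≤ d ^ 2 / 2 * 4 :=
        mul_le_mul (by linarith) (by nlinarith) (by nlinarith) (by positivity)
      linarith
    have h6 := sq_le_sq.1 h5
    rw [abs_mul, abs_mul, abs_two]
    rw [abs_mul, abs_two] at h6
    calc 2 * |d| * |deriv φ x| ≤ 2 * |d| * (2 * |d|) :=
          mul_le_mul_of_nonneg_left h6 (by positivity)
      _ = 4 * |d| ^ 2 := by ring
      _ = 4 * g x := by rw [sq_abs]
  have hexp : ∀ (r x : ℝ), HasDerivAt (fun x => g x * Real.exp (r * x))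
      ((2 * (φ x - k * (2 * Real.pi)) * deriv φ x + r * g x) * Real.exp (r * x)) x := fun r x => by
    have := (hg x).mul (((hasDerivAt_id x).const_mul r).exp)
    refine this.congr_deriv ?_
    simp only [id]; ring
  have hcont : ∀ r : ℝ, Continuous fun x => g x * Real.exp (r * x) := fun r =>
    continuous_iff_continuousAt.2 fun x => (hexp r x).continuousAt
  have hup : MonotoneOn (fun x => g x * Real.exp (4 * x)) (Iic 0) := by
    refine monotoneOn_of_deriv_nonneg (convex_Iic 0) (hcont 4).continuousOn
      (fun x _ => (hexp 4 x).differentiableAt.differentiableWithinAt) fun x hx => ?_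
    rw [interior_Iic] at hx
    rw [(hexp 4 x).deriv]
    exact mul_nonneg (by linarith [(abs_le.1 (hb x hx.le)).1]) (Real.exp_pos _).le
  have hdown : AntitoneOn (fun x => g x * Real.exp (-4 * x)) (Iic 0) := by
    refine antitoneOn_of_deriv_nonpos (convex_Iic 0) (hcont (-4)).continuousOn
      (fun x _ => (hexp (-4) x).differentiableAt.differentiableWithinAt) fun x hx => ?_
    rw [interior_Iic] at hx
    rw [(hexp (-4) x).deriv]
    exact mul_nonpos_of_nonpos_of_nonneg (by linarith [(abs_le.1 (hb x hx.le)).2])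
      (Real.exp_pos _).le
  have hgx : g x = 0 := by simp [g, hk]
  have hz : ∀ y ≤ 0, g y = 0 := fun y hy => by
    refine le_antisymm ?_ (sq_nonneg _)
    rcases le_total y x with hyx | hyx
    · have := hup hy hx hyx
      simp only [hgx, zero_mul] at this
      exact nonpos_of_mul_nonpos_left this (Real.exp_pos _)
    · have := hdown hx hy hyx
      simp only [hgx, zero_mul] at this
      exact nonpos_of_mul_nonpos_left this (Real.exp_pos _)
  have h0 : Real.cos (φ 0) = 1 := by
    have : φ 0 = k * (2 * Real.pi) := sub_eq_zero.1 (pow_eq_zero_iff (two_ne_zero)|>.1 (hz 0 le_rfl))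
    rw [this, Real.cos_int_mul_two_pi]
  rw [h.cos_zero ha] at h0
  exact zero_ne_one h0

theorem bounds_aux (h : IsThreePiKink a φ) (ha : a ^ 2 / 12 ≤ 1 / 100) :
    φ 0 < 2 * Real.pi ∧ ((∀ x ≤ 0, φ x < 0) ∨ ∀ x ≤ 0, 0 < φ x ∧ φ x < 2 * Real.pi) := by
  have hc := h.differentiable.continuous.continuousOn (s := Iic 0)
  have h0 := lt_or_gt_of_ne_on_Iic hc (c := 0) fun x hx => by
    simpa using h.ne_equilibrium ha 0 hx
  have h1 : ∀ x ≤ 0, φ x < 2 * Real.pi := by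
    refine (lt_or_gt_of_ne_on_Iic hc (c := 2 * Real.pi) fun x hx => by
      simpa using h.ne_equilibrium ha 1 hx).resolve_right fun hgt => ?_
    have := ge_of_tendsto h.tendsto_atBot ((eventually_le_atBot 0).mono fun x hx => (hgt x hx).le)
    linarith [Real.pi_pos]
  exact ⟨h1 0 le_rfl, h0.imp id fun hp x hx => ⟨hp x hx, h1 x hx⟩⟩

/-- The negative alternative fails because `bounds_aux` for the reflected kink gives `φ 0 > π`. -/
theorem mem_Ioo (h : IsThreePiKink a φ) (ha : a ^ 2 / 12 ≤ 1 / 100) {x : ℝ} (hx : x ≤ 0) :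
    0 < φ x ∧ φ x < 2 * Real.pi := by
  refine ((h.bounds_aux ha).2.resolve_left fun hneg => ?_) x hx
  have h1 := (h.reflect.bounds_aux ha).1
  have h2 := hneg 0 le_rfl
  simp only [neg_zero] at h1
  linarith [Real.pi_pos]

theorem value_zero (h : IsThreePiKink a φ) (ha : a ^ 2 / 12 ≤ 1 / 100) :
    φ 0 = 3 * Real.pi / 2 := by
  have h1 := h.mem_Ioo ha le_rfl
  have h2 := h.reflect.mem_Ioo ha le_rfl
  simp only [neg_zero] at h2
  have h3 : Real.sin (φ 0 - 3 * Real.pi / 2) = 0 := by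
    rw [show φ 0 - 3 * Real.pi / 2 = Real.pi / 2 + φ 0 - 2 * Real.pi by ring, Real.sin_sub_two_pi,
      add_comm, Real.sin_add_pi_div_two, h.cos_zero ha]
  have h4 := (Real.sin_eq_zero_iff_of_lt_of_lt (by linarith [Real.pi_pos])
    (by linarith [Real.pi_pos])).1 h3
  linarith

/-- By the first integral `φ_x` vanishes only at equilibria. Were it negative, `φ` would decrease
from its limit `0` to the positive value `φ 0`. -/
theorem deriv_pos_left (h : IsThreePiKink a φ) (ha : a ^ 2 / 12 ≤ 1 / 100) {x : ℝ} (hx : x ≤ 0) :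
    0 < deriv φ x := by
  have hc := h.continuous_deriv.continuousOn (s := Iic 0)
  have hne : ∀ x ≤ 0, deriv φ x ≠ 0 := fun x hx h0 => by
    have h1 := h.first_integral ha hx
    have h2 := h.mem_Ioo ha hx
    rw [h0] at h1
    have h3 : Real.cos (φ x) ≠ 1 := fun h4 => by
      have := (Real.cos_eq_one_iff_of_lt_of_lt (by linarith) h2.2).1 h4
      linarith
    have h5 : 0 < 2 + a ^ 2 / 12 * (1 + Real.cos (φ x)) := by
      have : 0 ≤ a ^ 2 / 12 * (1 + Real.cos (φ x)) :=
        mul_nonneg (by positivity) (by linarith [Real.neg_one_le_cos (φ x)])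
      linarith
    have h6 : (1 - Real.cos (φ x)) * (2 + a ^ 2 / 12 * (1 + Real.cos (φ x))) = 0 := by
      rw [← h1]; ring
    rcases mul_eq_zero.1 h6 with h7 | h7
    · exact h3 (by linarith)
    · exact h5.ne' h7
  refine (lt_or_gt_of_ne_on_Iic hc hne).resolve_left (fun hneg => ?_) x hx
  have hanti : AntitoneOn φ (Iic 0) :=
    antitoneOn_of_deriv_nonpos (convex_Iic 0) h.differentiable.continuous.continuousOn
      h.differentiable.differentiableOn fun x hx => by
        rw [interior_Iic] at hx; exact (hneg x (le_of_lt hx)).le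
  have := ge_of_tendsto h.tendsto_atBot ((eventually_le_atBot 0).mono fun x hx =>
    hanti hx (mem_Iic.2 le_rfl) hx)
  linarith [(h.mem_Ioo ha le_rfl).1]

end IsThreePiKink

/-! ### The linearization in terms of `y` -/

theorem one_sub_tanh_sq_pos (y : ℝ) : 0 < 1 - Real.tanh y ^ 2 := by
  have h1 := Real.neg_one_lt_tanh y
  have h2 := Real.tanh_lt_one y
  nlinarith

theorem stiffness_bounds {e T : ℝ} (he : 0 ≤ e) (he' : e ≤ 1 / 100) (hT : T ^ 2 ≤ 1) :
    0.98 ≤ stiffness e T ∧ stiffness e T ≤ 1 + 2 * e := by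
  have := mul_le_mul_of_nonneg_left hT he
  have := mul_nonneg he (sq_nonneg T)
  unfold stiffness
  constructor <;> linarith

theorem speedSq_bounds {e T : ℝ} (he : 0 ≤ e) (he' : e ≤ 1 / 100) (hT : T ^ 2 ≤ 1) :
    0.9 ≤ speedSq e T ∧ speedSq e T ≤ 1.1 := by
  have h1 := stiffness_bounds he he' hT
  have h2 := mul_le_mul_of_nonneg_left hT he
  have h3 := mul_nonneg he (sq_nonneg T)
  have hp : 0 < stiffness e T := by linarith
  unfold speedSq
  rw [← div_eq_mul_inv, le_div_iff₀ hp, div_le_iff₀ hp]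
  constructor <;> linarith

def kinkCoord (φ : ℝ → ℝ) (x : ℝ) : ℝ := Real.log (Real.tan (φ x / 4))

theorem tan_quarter_pos {u : ℝ} (hu : 0 < u ∧ u < 2 * Real.pi) : 0 < Real.tan (u / 4) :=
  Real.tan_pos_of_pos_of_lt_pi_div_two (by linarith) (by linarith)

theorem tanh_log_tan {u : ℝ} (hu : 0 < u ∧ u < 2 * Real.pi) :
    Real.tanh (Real.log (Real.tan (u / 4))) = -Real.cos (u / 2) := by
  have ht := tan_quarter_pos hu
  have hc : 0 < Real.cos (u / 4) :=
    Real.cos_pos_of_mem_Ioo ⟨by linarith [Real.pi_pos], by linarith⟩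
  rw [Real.tanh_eq_sinh_div_cosh, Real.sinh_log ht, Real.cosh_log ht,
    show u / 2 = 2 * (u / 4) by ring, Real.cos_two_mul']
  have hs : 0 < Real.sin (u / 4) := Real.sin_pos_of_pos_of_lt_pi (by linarith) (by linarith [Real.pi_pos])
  rw [Real.tan_eq_sin_div_cos]
  have h1 := Real.sin_sq_add_cos_sq (u / 4)
  field_simp
  rw [h1]
  ring

namespace IsThreePiKink

variable {a : ℝ} {φ : ℝ → ℝ}

theorem tanh_kinkCoord (h : IsThreePiKink a φ) (ha : a ^ 2 / 12 ≤ 1 / 100) {x : ℝ} (hx : x ≤ 0) :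
    Real.tanh (kinkCoord φ x) = -Real.cos (φ x / 2) :=
  tanh_log_tan (h.mem_Ioo ha hx)

theorem cos_eq (h : IsThreePiKink a φ) (ha : a ^ 2 / 12 ≤ 1 / 100) {x : ℝ} (hx : x ≤ 0) :
    Real.cos (φ x) = 2 * Real.tanh (kinkCoord φ x) ^ 2 - 1 := by
  rw [h.tanh_kinkCoord ha hx, neg_sq, ← Real.cos_two_mul]
  congr 1; ring

theorem sin_half_pos (h : IsThreePiKink a φ) (ha : a ^ 2 / 12 ≤ 1 / 100) {x : ℝ} (hx : x ≤ 0) :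
    0 < Real.sin (φ x / 2) := by
  have := h.mem_Ioo ha hx
  exact Real.sin_pos_of_pos_of_lt_pi (by linarith) (by linarith)

theorem sin_half_sq (h : IsThreePiKink a φ) (ha : a ^ 2 / 12 ≤ 1 / 100) {x : ℝ} (hx : x ≤ 0) :
    Real.sin (φ x / 2) ^ 2 = 1 - Real.tanh (kinkCoord φ x) ^ 2 := by
  rw [h.tanh_kinkCoord ha hx, Real.sin_sq]
  ring

theorem deriv_sq_eq (h : IsThreePiKink a φ) (ha : a ^ 2 / 12 ≤ 1 / 100) {x : ℝ} (hx : x ≤ 0) :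
    deriv φ x ^ 2 = 4 * (1 - Real.tanh (kinkCoord φ x) ^ 2)
      * speedSq (a ^ 2 / 12) (Real.tanh (kinkCoord φ x)) := by
  have h1 := h.first_integral ha hx
  rw [h.cos_eq ha hx] at h1
  have h2 := (stiffness_bounds (e := a ^ 2 / 12) (by positivity) ha (tanh_sq_le (kinkCoord φ x))).1
  have h3 : stiffness (a ^ 2 / 12) (Real.tanh (kinkCoord φ x)) ≠ 0 := by linarith
  rw [speedSq, ← mul_assoc, ← div_eq_mul_inv, eq_div_iff h3, stiffness]
  linear_combination h1

theorem deriv_eq (h : IsThreePiKink a φ) (ha : a ^ 2 / 12 ≤ 1 / 100) {x : ℝ} (hx : x ≤ 0) :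
    deriv φ x = 2 * Real.sin (φ x / 2)
      * √(speedSq (a ^ 2 / 12) (Real.tanh (kinkCoord φ x))) := by
  have h1 := h.sin_half_pos ha hx
  have h2 := (speedSq_bounds (e := a ^ 2 / 12) (by positivity) ha (tanh_sq_le (kinkCoord φ x))).1
  refine (sq_eq_sq₀ (h.deriv_pos_left ha hx).le (by positivity)).1 ?_
  rw [h.deriv_sq_eq ha hx, mul_pow, mul_pow, Real.sq_sqrt (by linarith), h.sin_half_sq ha hx]
  ring

/-- Here `dy = dφ / (2 sin (φ/2))`, while the first integral reads `φ_x = 2 sin (φ/2) √speedSq`. -/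
theorem hasDerivAt_kinkCoord (h : IsThreePiKink a φ) (ha : a ^ 2 / 12 ≤ 1 / 100) {x : ℝ}
    (hx : x ≤ 0) :
    HasDerivAt (kinkCoord φ) √(speedSq (a ^ 2 / 12) (Real.tanh (kinkCoord φ x))) x := by
  have hu := h.mem_Ioo ha hx
  have ht := tan_quarter_pos hu
  have hc : 0 < Real.cos (φ x / 4) :=
    Real.cos_pos_of_mem_Ioo ⟨by linarith [Real.pi_pos], by linarith⟩
  have hs : 0 < Real.sin (φ x / 4) :=
    Real.sin_pos_of_pos_of_lt_pi (by linarith) (by linarith [Real.pi_pos])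
  have h1 := ((Real.hasDerivAt_log ht.ne').comp x ((Real.hasDerivAt_tan hc.ne').comp x
    ((h.differentiable x).hasDerivAt.div_const 4)))
  refine HasDerivAt.congr_deriv (f := kinkCoord φ) h1 ?_
  rw [h.deriv_eq ha hx, show φ x / 2 = 2 * (φ x / 4) by ring, Real.sin_two_mul]
  rw [Real.tan_eq_sin_div_cos]
  field_simp
  norm_num

theorem sin_mul_deriv (h : IsThreePiKink a φ) (ha : a ^ 2 / 12 ≤ 1 / 100) {x : ℝ} (hx : x ≤ 0) :
    deriv φ x * Real.sin (φ x) = -4 * Real.tanh (kinkCoord φ x)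
      * (1 - Real.tanh (kinkCoord φ x) ^ 2)
      * √(speedSq (a ^ 2 / 12) (Real.tanh (kinkCoord φ x))) := by
  rw [h.deriv_eq ha hx, ← h.sin_half_sq ha hx, h.tanh_kinkCoord ha hx,
    show Real.sin (φ x) = Real.sin (2 * (φ x / 2)) by congr 1; ring, Real.sin_two_mul]
  ring

theorem sin_mul_deriv_deriv (h : IsThreePiKink a φ) (ha : a ^ 2 / 12 ≤ 1 / 100) {x : ℝ}
    (hx : x < 0) :
    deriv (deriv φ) x * Real.sin (φ x) = 4 * Real.tanh (kinkCoord φ x) ^ 2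
      * (1 - Real.tanh (kinkCoord φ x) ^ 2)
      * (1 + 4 * (a ^ 2 / 12) * (1 - Real.tanh (kinkCoord φ x) ^ 2)
          * speedSq (a ^ 2 / 12) (Real.tanh (kinkCoord φ x))
        + a ^ 2 / 12 * (2 * Real.tanh (kinkCoord φ x) ^ 2 - 1))
      * (stiffness (a ^ 2 / 12) (Real.tanh (kinkCoord φ x)))⁻¹ := by
  have h1 := h.static_left hx
  have h2 := (stiffness_bounds (e := a ^ 2 / 12) (by positivity) ha (tanh_sq_le (kinkCoord φ x))).1
  have h3 : stiffness (a ^ 2 / 12) (Real.tanh (kinkCoord φ x)) ≠ 0 := by linarith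
  have h4 : Real.sin (φ x) ^ 2 = 4 * Real.tanh (kinkCoord φ x) ^ 2
      * (1 - Real.tanh (kinkCoord φ x) ^ 2) := by
    rw [Real.sin_sq, h.cos_eq ha hx.le]; ring
  rw [h.deriv_sq_eq ha hx.le, h.cos_eq ha hx.le] at h1
  rw [← h4, ← div_eq_mul_inv, eq_div_iff h3]
  rw [stiffness] at *
  linear_combination Real.sin (φ x) * h1

theorem kinkCoord_zero (h : IsThreePiKink a φ) (ha : a ^ 2 / 12 ≤ 1 / 100) :
    kinkCoord φ 0 = y₀ := by
  apply Real.tanh_injective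
  rw [h.tanh_kinkCoord ha le_rfl, tanh_y₀, h.value_zero ha,
    show 3 * Real.pi / 2 / 2 = Real.pi - Real.pi / 4 by ring, Real.cos_pi_sub,
    Real.cos_pi_div_four, neg_neg]

theorem tendsto_kinkCoord (h : IsThreePiKink a φ) (ha : a ^ 2 / 12 ≤ 1 / 100) :
    Tendsto (fun x => Real.tanh (kinkCoord φ x)) atBot (𝓝 (-1)) := by
  have h1 : Tendsto (fun x => -Real.cos (φ x / 2)) atBot (𝓝 (-Real.cos (0 / 2))) :=
    ((Real.continuous_cos.tendsto _).comp (h.tendsto_atBot.div_const 2)).neg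
  rw [zero_div, Real.cos_zero] at h1
  refine h1.congr' ?_
  filter_upwards [eventually_le_atBot 0] with x hx
  rw [h.tanh_kinkCoord ha hx]

end IsThreePiKink

/-- A coordinate which increases with the speed of the kink up to `x = 0` and then decreases
symmetrically. -/
structure KinkProfile (e : ℝ) (Y : ℝ → ℝ) : Prop where
  continuous : Continuous Y
  zero : Y 0 = y₀
  left : ∀ x < 0, HasDerivAt Y √(speedSq e (Real.tanh (Y x))) x
  right : ∀ x > 0, HasDerivAt Y (-√(speedSq e (Real.tanh (Y x)))) x
  tendsto_atBot : Tendsto (fun x => Real.tanh (Y x)) atBot (𝓝 (-1))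
  tendsto_atTop : Tendsto (fun x => Real.tanh (Y x)) atTop (𝓝 (-1))

/-- The state enters only through these four combinations. They have the same form on both half
lines once `d` carries the sign of the derivative of the profile. -/
theorem linearization_of_coeff {a th u ux uxx T d : ℝ} (hC : Real.cos (u + th) = 2 * T ^ 2 - 1)
    (hA : ux * Real.sin (u + th) = -4 * T * (1 - T ^ 2) * d)
    (hB : uxx * Real.sin (u + th) = 4 * T ^ 2 * (1 - T ^ 2)
      * (1 + 4 * (a ^ 2 / 12) * (1 - T ^ 2) * speedSq (a ^ 2 / 12) T
        + a ^ 2 / 12 * (2 * T ^ 2 - 1)) * (stiffness (a ^ 2 / 12) T)⁻¹)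
    (hD : ux ^ 2 = 4 * (1 - T ^ 2) * speedSq (a ^ 2 / 12) T) (s v vx vxx : ℂ) :
    linearization a th s u ux uxx v vx vxx
      = ((stiffness (a ^ 2 / 12) T : ℝ) + 2 * (a ^ 2 / 12 : ℝ) * s ^ 2) * vxx
        + (8 * (a ^ 2 / 12) * T * (1 - T ^ 2) * d : ℝ) * vx
        - ((potential (a ^ 2 / 12) 0 T : ℝ) + s ^ 2 * (stiffness (a ^ 2 / 12) T : ℝ)
          + (a ^ 2 / 12 : ℝ) * (s ^ 2) ^ 2) * v := by
  rw [linearization_eq]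
  have eC : Complex.cos (u + th) = ((2 * T ^ 2 - 1 : ℝ) : ℂ) := by rw [← hC]; push_cast; rfl
  have eA : (ux : ℂ) * Complex.sin (u + th) = ((-4 * T * (1 - T ^ 2) * d : ℝ) : ℂ) := by
    rw [← hA]; push_cast; rfl
  set B : ℝ := uxx * Real.sin (u + th) with hB'
  have eB : (uxx : ℂ) * Complex.sin (u + th) = (B : ℂ) := by
    rw [hB']; push_cast; rfl
  set D : ℝ := ux ^ 2 with hD'
  have eD : (ux : ℂ) ^ 2 = (D : ℂ) := by rw [hD']; push_cast; rfl
  have eV : potential (a ^ 2 / 12) 0 T = (2 * T ^ 2 - 1)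
      - a ^ 2 / 12 * (1 - 2 * (2 * T ^ 2 - 1) ^ 2 - 2 * B - D * (2 * T ^ 2 - 1)) := by
    rw [hB, hD, potential, potentialPoly, potentialCorr, speedSq]
    ring
  rw [eV, eC, eD, stiffness]
  push_cast at eA eB ⊢
  linear_combination (-(a : ℂ) ^ 2 / 6 * vx) * eA - (a : ℂ) ^ 2 / 6 * v * eB

/-- Every kink has a profile, and its linearization is expressed through it. -/
theorem IsThreePiKink.exists_profile {a : ℝ} {φ : ℝ → ℝ} (h : IsThreePiKink a φ)
    (ha : a ^ 2 / 12 ≤ 1 / 100) :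
    ∃ Y : ℝ → ℝ, KinkProfile (a ^ 2 / 12) Y ∧ ∀ x, x ≠ 0 → ∀ s v vx vxx : ℂ,
      linearization a (theta x) s (φ x : ℝ) (deriv φ x : ℝ) (deriv (deriv φ) x : ℝ) v vx vxx
      = ((stiffness (a ^ 2 / 12) (Real.tanh (Y x)) : ℝ) + 2 * (a ^ 2 / 12 : ℝ) * s ^ 2) * vxx
        + (8 * (a ^ 2 / 12) * Real.tanh (Y x) * (1 - Real.tanh (Y x) ^ 2) * deriv Y x : ℝ) * vx
        - ((potential (a ^ 2 / 12) 0 (Real.tanh (Y x)) : ℝ)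
          + s ^ 2 * (stiffness (a ^ 2 / 12) (Real.tanh (Y x)) : ℝ)
          + (a ^ 2 / 12 : ℝ) * (s ^ 2) ^ 2) * v := by
  have h' := h.reflect
  set χ : ℝ → ℝ := fun x => 3 * Real.pi - φ (-x) with hχ
  -- On each half line one summand is constantly `y₀`, so this glues the two coordinates
  -- continuously.
  let Y : ℝ → ℝ := fun x => kinkCoord φ (min x 0) + kinkCoord χ (min (-x) 0) - y₀
  have hl : ∀ x ≤ 0, Y x = kinkCoord φ x := fun x hx => by
    simp only [Y]
    rw [min_eq_left hx, min_eq_right (by linarith), h'.kinkCoord_zero ha]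
    ring
  have hr : ∀ x ≥ 0, Y x = kinkCoord χ (-x) := fun x hx => by
    simp only [Y]
    rw [min_eq_right hx, min_eq_left (by linarith), h.kinkCoord_zero ha]
    ring
  have hYl : ∀ x < 0, HasDerivAt Y √(speedSq (a ^ 2 / 12) (Real.tanh (Y x))) x := fun x hx => by
    rw [hl x hx.le]
    refine (h.hasDerivAt_kinkCoord ha hx.le).congr_of_eventuallyEq ?_
    filter_upwards [Iio_mem_nhds hx] with z hz using hl z (le_of_lt hz)
  have hYr : ∀ x > 0, HasDerivAt Y (-√(speedSq (a ^ 2 / 12) (Real.tanh (Y x)))) x := fun x hx => by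
    rw [hr x (le_of_lt hx)]
    have hx' : -x ≤ 0 := by linarith [show 0 < x from hx]
    have := (h'.hasDerivAt_kinkCoord ha hx').comp x (hasDerivAt_neg x)
    rw [mul_neg, mul_one] at this
    refine this.congr_of_eventuallyEq ?_
    filter_upwards [Ioi_mem_nhds hx] with z hz using hr z (le_of_lt hz)
  refine ⟨Y, ⟨?_, ?_, hYl, hYr, ?_, ?_⟩, ?_⟩
  · have c1 : ContinuousOn (kinkCoord φ) (Iic 0) := fun x hx =>
      (h.hasDerivAt_kinkCoord ha hx).continuousAt.continuousWithinAt
    have c2 : ContinuousOn (kinkCoord χ) (Iic 0) := fun x hx =>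
      (h'.hasDerivAt_kinkCoord ha hx).continuousAt.continuousWithinAt
    exact ((c1.comp_continuous (by fun_prop) fun x => mem_Iic.2 (min_le_right _ _)).add
      (c2.comp_continuous (by fun_prop) fun x => mem_Iic.2 (min_le_right _ _))).sub continuous_const
  · rw [hl 0 le_rfl, h.kinkCoord_zero ha]
  · refine (h.tendsto_kinkCoord ha).congr' ?_
    filter_upwards [eventually_le_atBot 0] with x hx
    rw [hl x hx]
  · refine ((h'.tendsto_kinkCoord ha).comp tendsto_neg_atTop_atBot).congr' ?_
    filter_upwards [eventually_ge_atTop 0] with x hx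
    rw [hr x hx, Function.comp_apply]
  · intro x hx s v vx vxx
    rcases lt_or_gt_of_ne hx with hx | hx
    · have hth : φ x + theta x = φ x := by rw [theta, if_neg hx.not_gt, add_zero]
      rw [(hYl x hx).deriv]
      refine linearization_of_coeff ?_ ?_ ?_ ?_ s v vx vxx
      · rw [hth, hl x hx.le, h.cos_eq ha hx.le]
      · rw [hth, hl x hx.le, h.sin_mul_deriv ha hx.le]
      · rw [hth, hl x hx.le, h.sin_mul_deriv_deriv ha hx]
      · rw [hl x hx.le, h.deriv_sq_eq ha hx.le]
    · have hx' : -x < 0 := by linarith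
      -- The right half is read off from the reflected kink `χ` at `-x`: the cosine and the first
      -- derivative agree, the sine and the second derivative change sign.
      have e1 : Real.cos (φ x + theta x) = Real.cos (χ (-x)) := by
        have := IsThreePiKink.cos_reflect (φ x) (x := -x) (by linarith)
        rw [neg_neg, theta, if_neg hx'.not_gt, add_zero] at this
        rw [← this]; simp [hχ]
      have e2 : Real.sin (φ x + theta x) = -Real.sin (χ (-x)) := by
        have := IsThreePiKink.sin_reflect (φ x) (x := -x) (by linarith)
        rw [neg_neg, theta, if_neg hx'.not_gt, add_zero] at this
        simp [hχ, this]
      have e3 : deriv φ x = deriv χ (-x) := by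
        rw [hχ, IsThreePiKink.deriv_reflect]; simp
      have e4 : deriv (deriv φ) x = -deriv (deriv χ) (-x) := by
        rw [hχ, IsThreePiKink.deriv_deriv_reflect]; simp
      rw [(hYr x hx).deriv]
      refine linearization_of_coeff ?_ ?_ ?_ ?_ s v vx vxx
      · rw [e1, hr x hx.le, h'.cos_eq ha hx'.le]
      · rw [e2, e3, mul_neg, h'.sin_mul_deriv ha hx'.le, hr x hx.le]
        ring
      · rw [e2, e4, neg_mul_neg, h'.sin_mul_deriv_deriv ha hx', hr x hx.le]
      · rw [e3, hr x hx.le, h'.deriv_sq_eq ha hx'.le]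

/-! ### Quadratic eigenvalue problems on the line -/

/-- Integrability of `f` and `f'` makes `f` vanish at both ends, and continuity makes the boundary
terms at `0` cancel. -/
theorem integral_eq_zero_of_hasDerivAt_off_zero {E : Type*} [NormedAddCommGroup E]
    [NormedSpace ℝ E] [CompleteSpace E] {f f' : ℝ → E} (hc : Continuous f)
    (hd : ∀ x, x ≠ 0 → HasDerivAt f (f' x) x) (hf : Integrable f) (hf' : Integrable f') :
    ∫ x, f' x = 0 := by
  have h1 : Tendsto f atBot (𝓝 0) := tendsto_zero_of_hasDerivAt_of_integrableOn_Iic (a := -1)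
    (fun x hx => hd x (by have := mem_Iic.1 hx; intro h; linarith)) hf'.integrableOn hf.integrableOn
  have h2 : Tendsto f atTop (𝓝 0) := tendsto_zero_of_hasDerivAt_of_integrableOn_Ioi (a := 1)
    (fun x hx => hd x (by have := mem_Ioi.1 hx; intro h; linarith)) hf'.integrableOn hf.integrableOn
  have h3 := integral_Iic_of_hasDerivAt_of_tendsto hc.continuousWithinAt
    (fun x hx => hd x (ne_of_lt hx)) hf'.integrableOn h1
  have h4 := integral_Ioi_of_hasDerivAt_of_tendsto hc.continuousWithinAt
    (fun x hx => hd x (ne_of_gt hx)) hf'.integrableOn h2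
  rw [← intervalIntegral.integral_Iic_add_Ioi (b := 0) hf'.integrableOn hf'.integrableOn, h3, h4]
  simp

theorem integral_add_mul_add_mul {𝕜 : Type*} [RCLike 𝕜] {f g k : ℝ → 𝕜} (hf : Integrable f)
    (hg : Integrable g) (hk : Integrable k) (b c : 𝕜) :
    ∫ x, (f x + b * g x + c * k x) = (∫ x, f x) + b * (∫ x, g x) + c * ∫ x, k x := by
  have h1 : Integrable fun x => f x + b * g x := hf.add (hg.const_mul b)
  rw [integral_add h1 (hk.const_mul c), integral_add hf (hg.const_mul b), integral_const_mul,
    integral_const_mul]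

namespace MemH2

variable {w w1 w2 : ℝ → ℂ}

theorem continuous_zero (h : MemH2 w w1 w2) : Continuous w :=
  continuous_iff_continuousAt.2 fun x => (h.hasDerivAt x).continuousAt

theorem intervalIntegrable_two (h : MemH2 w w1 w2) (x y : ℝ) :
    IntervalIntegrable w2 volume x y :=
  ((h.memLp_two.locallyIntegrable (by norm_num)).integrableOn_isCompact
    isCompact_uIcc).intervalIntegrable

theorem continuous_one (h : MemH2 w w1 w2) : Continuous w1 := by
  have e : w1 = fun y => w1 0 + ∫ t in (0 : ℝ)..y, w2 t := by
    funext y; rw [h.integral_eq]; ring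
  rw [e]
  exact continuous_const.add
    (intervalIntegral.continuous_primitive (fun a b => h.intervalIntegrable_two a b) 0)

theorem integrable_zero (h : MemH2 w w1 w2) : Integrable fun x => ‖w x‖ ^ 2 :=
  h.memLp_zero.norm.integrable_sq

theorem integrable_one (h : MemH2 w w1 w2) : Integrable fun x => ‖w1 x‖ ^ 2 :=
  h.memLp_one.norm.integrable_sq

/-- If the second derivative agrees almost everywhere with a function that is continuous off `0`,
then it is a classical derivative off `0`. -/
theorem hasDerivAt_one (h : MemH2 w w1 w2) {g : ℝ → ℂ} (hg : ∀ x, x ≠ 0 → ContinuousAt g x)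
    (he : ∀ᵐ x : ℝ, w2 x = g x) {x : ℝ} (hx : x ≠ 0) : HasDerivAt w1 (g x) x := by
  have hi : ∀ a b : ℝ, IntervalIntegrable g volume a b := fun a b =>
    (h.intervalIntegrable_two a b).congr_ae (ae_restrict_of_ae he)
  have e : w1 = fun y => w1 0 + ∫ t in (0 : ℝ)..y, g t := by
    funext y
    rw [← intervalIntegral.integral_congr_ae (he.mono fun t ht _ => ht), h.integral_eq]
    ring
  rw [e]
  have hco : ContinuousOn g {0}ᶜ := fun y hy => (hg y hy).continuousWithinAt
  exact (intervalIntegral.integral_hasDerivAt_right (hi 0 x)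
    (hco.stronglyMeasurableAtFilter isOpen_compl_singleton x hx) (hg x hx)).const_add _

theorem integral_pos (h : MemH2 w w1 w2) (hw : w ≠ 0) : 0 < ∫ x, ‖w x‖ ^ 2 := by
  have hc : Continuous fun x => ‖w x‖ ^ 2 := h.continuous_zero.norm.pow 2
  rw [integral_pos_iff_support_of_nonneg (fun x => sq_nonneg _) h.integrable_zero]
  refine hc.isOpen_support.measure_pos _ ?_
  obtain ⟨x, hx⟩ := Function.ne_iff.1 hw
  exact ⟨x, by simpa using hx⟩

end MemH2

/-- Coefficients of the problem `((p + 2 e Λ) w')' = (V + Λ p + e Λ²) w`. -/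
structure SturmData (e : ℝ) (p pd V : ℝ → ℝ) : Prop where
  nonneg : 0 ≤ e
  le : e ≤ 1 / 100
  cont_p : Continuous p
  cont_V : Continuous V
  cont_pd : ∀ x, x ≠ 0 → ContinuousAt pd x
  meas_pd : Measurable pd
  deriv_p : ∀ x, x ≠ 0 → HasDerivAt p (pd x) x
  p_ge : ∀ x, 0.98 ≤ p x
  p_le : ∀ x, p x ≤ 1 + 2 * e
  V_le : ∀ x, |V x| ≤ 2
  pd_le : ∀ x, x ≠ 0 → |pd x| ≤ 1

namespace SturmData

variable {e : ℝ} {p pd V : ℝ → ℝ} {w w1 w2 : ℝ → ℂ}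

/-- The equation at a point. -/
def Eqn (e : ℝ) (p pd V : ℝ → ℝ) (L : ℂ) (w w1 w2 : ℝ → ℂ) (x : ℝ) : Prop :=
  ((p x : ℂ) + 2 * e * L) * w2 x + pd x * w1 x - ((V x : ℂ) + L * p x + e * L ^ 2) * w x = 0

def formA (p V : ℝ → ℝ) (w w1 : ℝ → ℂ) (x : ℝ) : ℝ := p x * ‖w1 x‖ ^ 2 + V x * ‖w x‖ ^ 2

def formB (e : ℝ) (p : ℝ → ℝ) (w w1 : ℝ → ℂ) (x : ℝ) : ℝ :=
  2 * e * ‖w1 x‖ ^ 2 + p x * ‖w x‖ ^ 2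

theorem p_abs (d : SturmData e p pd V) (x : ℝ) : |p x| ≤ 2 := by
  have := d.p_ge x
  have := d.p_le x
  have := d.le
  rw [abs_le]; constructor <;> linarith

theorem integrable_mul_sq {f : ℝ → ℝ} {g : ℝ → ℂ} {M : ℝ} (hf : Continuous f)
    (hM : ∀ x, |f x| ≤ M) (hg : Integrable fun x => ‖g x‖ ^ 2) :
    Integrable fun x => f x * ‖g x‖ ^ 2 :=
  hg.bdd_mul hf.aestronglyMeasurable (Eventually.of_forall hM)

theorem integrable_formA (d : SturmData e p pd V) (h : MemH2 w w1 w2) :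
    Integrable (formA p V w w1) :=
  (integrable_mul_sq d.cont_p d.p_abs h.integrable_one).add
    (integrable_mul_sq d.cont_V d.V_le h.integrable_zero)

theorem integrable_formB (d : SturmData e p pd V) (h : MemH2 w w1 w2) :
    Integrable (formB e p w w1) :=
  (h.integrable_one.const_mul (2 * e)).add
    (integrable_mul_sq d.cont_p d.p_abs h.integrable_zero)

/-- The energy identity of an eigenfunction. -/
theorem energy (d : SturmData e p pd V) (h : MemH2 w w1 w2) {L : ℂ}
    (hne : ∀ x, (p x : ℂ) + 2 * e * L ≠ 0) (heq : ∀ᵐ x : ℝ, Eqn e p pd V L w w1 w2 x) :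
    ((∫ x, formA p V w w1 x : ℝ) : ℂ) + L * (∫ x, formB e p w w1 x : ℝ)
      + e * L ^ 2 * (∫ x, ‖w x‖ ^ 2 : ℝ) = 0 := by
  let P : ℝ → ℂ := fun x => (p x : ℂ) + 2 * e * L
  let Q : ℝ → ℂ := fun x => (V x : ℂ) + L * p x + e * L ^ 2
  have cw := h.continuous_zero
  have cw1 := h.continuous_one
  have cp := d.cont_p
  have cV := d.cont_V
  have cP : Continuous P := by fun_prop
  have cQ : Continuous Q := by fun_prop
  -- The equation solved for `w''`: continuous off `0`, so the flux `P w' conj(w)` is classically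
  -- differentiable there.
  let g : ℝ → ℂ := fun x => (Q x * w x - pd x * w1 x) / P x
  have hg : ∀ x, x ≠ 0 → ContinuousAt g x := fun x hx =>
    ((cQ.continuousAt.mul cw.continuousAt).sub
      ((Complex.continuous_ofReal.continuousAt.comp (d.cont_pd x hx)).mul cw1.continuousAt)).div
      cP.continuousAt (hne x)
  have hw2 : ∀ᵐ x : ℝ, w2 x = g x := heq.mono fun x hx => by
    rw [eq_div_iff (hne x)]
    simp only [Eqn] at hx
    simp only [Q]
    linear_combination hx
  have hflux : ∀ x, x ≠ 0 → HasDerivAt (fun x => P x * w1 x * conj (w x))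
      (Q x * w x * conj (w x) + P x * w1 x * conj (w1 x)) x := fun x hx => by
    have hP : HasDerivAt P (pd x) x := (d.deriv_p x hx).ofReal_comp.add_const _
    have h1 := (hP.mul (h.hasDerivAt_one hg hw2 hx)).mul (h.hasDerivAt x).star
    refine h1.congr_deriv ?_
    have : P x * g x = Q x * w x - pd x * w1 x := mul_div_cancel₀ _ (hne x)
    simp only [starRingEnd_apply]
    simp only [Pi.mul_apply]
    rw [this]
    ring
  have hform : ∀ x, Q x * w x * conj (w x) + P x * w1 x * conj (w1 x)
      = ((formA p V w w1 x : ℝ) : ℂ) + L * (formB e p w w1 x : ℝ)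
        + e * L ^ 2 * (‖w x‖ ^ 2 : ℝ) := fun x => by
    rw [mul_assoc, mul_assoc, Complex.mul_conj', Complex.mul_conj', formA, formB]
    simp only [P, Q]
    push_cast
    ring
  have iA : Integrable fun x => ((formA p V w w1 x : ℝ) : ℂ) := (d.integrable_formA h).ofReal
  have iB : Integrable fun x => ((formB e p w w1 x : ℝ) : ℂ) := (d.integrable_formB h).ofReal
  have iN : Integrable fun x => ((‖w x‖ ^ 2 : ℝ) : ℂ) := h.integrable_zero.ofReal
  have hi : Integrable fun x => P x * w1 x * conj (w x) := by
    refine ((h.integrable_zero.add h.integrable_one).const_mul (2 + ‖2 * e * L‖)).mono'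
      ((cP.mul cw1).mul (Complex.continuous_conj.comp cw)).aestronglyMeasurable
      (Eventually.of_forall fun x => ?_)
    rw [norm_mul, norm_mul, RCLike.norm_conj]
    have h1 : ‖P x‖ ≤ 2 + ‖2 * e * L‖ := by
      refine (norm_add_le _ _).trans (add_le_add_left ?_ _)
      rw [Complex.norm_real]; exact d.p_abs x
    have h2 : ‖w1 x‖ * ‖w x‖ ≤ ‖w x‖ ^ 2 + ‖w1 x‖ ^ 2 := by
      nlinarith [sq_nonneg (‖w x‖ - ‖w1 x‖), sq_nonneg ‖w x‖, sq_nonneg ‖w1 x‖]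
    rw [mul_assoc]
    exact mul_le_mul h1 h2 (by positivity) (by positivity)
  have h0 := integral_eq_zero_of_hasDerivAt_off_zero
    ((cP.mul cw1).mul (Complex.continuous_conj.comp cw)) hflux hi
    (by simp_rw [hform]; exact (iA.add (iB.const_mul L)).add (iN.const_mul _))
  simp_rw [hform] at h0
  rw [integral_add_mul_add_mul iA iB iN, integral_complex_ofReal, integral_complex_ofReal, integral_complex_ofReal] at h0
  exact h0

theorem integral_formB_pos (d : SturmData e p pd V) (h : MemH2 w w1 w2) (hw : w ≠ 0) :
    0 < ∫ x, formB e p w w1 x := by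
  have h1 := h.integral_pos hw
  have h2 : ∫ x, 0.98 * ‖w x‖ ^ 2 ≤ ∫ x, formB e p w w1 x :=
    integral_mono (h.integrable_zero.const_mul _) (d.integrable_formB h) fun x => by
      have := mul_nonneg (mul_nonneg zero_le_two d.nonneg) (sq_nonneg ‖w1 x‖)
      have := mul_le_mul_of_nonneg_right (d.p_ge x) (sq_nonneg ‖w x‖)
      simp only [formB]
      linarith
  rw [integral_const_mul] at h2
  linarith

/-- Eigenvalues are real. -/
theorem im_eq_zero (d : SturmData e p pd V) (h : MemH2 w w1 w2) (hw : w ≠ 0) {L : ℂ}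
    (heq : ∀ᵐ x : ℝ, Eqn e p pd V L w w1 w2 x) : L.im = 0 := by
  by_contra hL
  have hne : ∀ x, (p x : ℂ) + 2 * e * L ≠ 0 := fun x h0 => by
    have him := congrArg Complex.im h0
    have hre := congrArg Complex.re h0
    simp at him hre
    have he : e = 0 := him.resolve_right hL
    rw [he] at hre
    have := d.p_ge x
    linarith
  have hE := d.energy h hne heq
  have hN := h.integral_pos hw
  have hB := d.integral_formB_pos h hw
  have iA := d.integrable_formA h
  have iB := d.integrable_formB h
  set A := ∫ x, formA p V w w1 x
  set B := ∫ x, formB e p w w1 x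
  set N := ∫ x, ‖w x‖ ^ 2
  have him : L.im * (B + 2 * e * L.re * N) = 0 := by
    have := congrArg Complex.im hE
    simp [pow_two] at this
    linear_combination this
  have hre : A + L.re * B + e * (L.re ^ 2 - L.im ^ 2) * N = 0 := by
    have := congrArg Complex.re hE
    simp [pow_two] at this
    linear_combination this
  -- So `L.re` is the vertex of the real quadratic `t ↦ A + t B + e t² N`, which therefore equals `e
  -- ((t - L.re)² + L.im²) N` and is positive for every real `t`.
  have hB' := (mul_eq_zero.1 him).resolve_left hL
  have he : 0 < e := d.nonneg.lt_of_ne fun h0 => by rw [← h0] at hB'; linarith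
  -- Chosen so that `p + 2 e t ≤ 0` everywhere; both coefficients of the quadratic form are then
  -- nonpositive, a contradiction.
  set t : ℝ := -(1 + 2 * e) / (2 * e) with ht
  have ht' : 2 * e * t = -(1 + 2 * e) := by rw [ht]; field_simp
  have hQ : A + t * B + e * t ^ 2 * N = e * ((t - L.re) ^ 2 + L.im ^ 2) * N := by
    linear_combination hre + (t - L.re) * hB'
  have hint : A + t * B + e * t ^ 2 * N
      = ∫ x, (formA p V w w1 x + t * formB e p w w1 x + e * t ^ 2 * ‖w x‖ ^ 2) := by
    rw [integral_add_mul_add_mul iA iB h.integrable_zero]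
  have hneg : ∫ x, (formA p V w w1 x + t * formB e p w w1 x + e * t ^ 2 * ‖w x‖ ^ 2) ≤ 0 := by
    refine integral_nonpos fun x => ?_
    have e1 : formA p V w w1 x + t * formB e p w w1 x + e * t ^ 2 * ‖w x‖ ^ 2
        = (p x + 2 * e * t) * ‖w1 x‖ ^ 2 + (V x + t * (p x + e * t)) * ‖w x‖ ^ 2 := by
      rw [formA, formB]; ring
    have h1 : p x + 2 * e * t ≤ 0 := by rw [ht']; linarith [d.p_le x]
    have h2 : V x + t * (p x + e * t) ≤ 0 := by
      have h3 : e * t = -(1 + 2 * e) / 2 := by linarith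
      have h4 : 0.4 ≤ p x + e * t := by linarith [d.p_ge x, d.le]
      have h5 : t ≤ -50 := by
        rw [ht, div_le_iff₀ (by linarith)]; linarith [d.le]
      have h6 := (abs_le.1 (d.V_le x)).2
      nlinarith
    simp only [e1, Pi.zero_apply]
    have := mul_nonpos_of_nonpos_of_nonneg h1 (sq_nonneg ‖w1 x‖)
    have := mul_nonpos_of_nonpos_of_nonneg h2 (sq_nonneg ‖w x‖)
    linarith
  have hpos : 0 < e * ((t - L.re) ^ 2 + L.im ^ 2) * N := by
    have : 0 < L.im ^ 2 := by positivity
    positivity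
  linarith

/-- A global solution of the Riccati equation makes the quadratic form nonnegative. -/
theorem form_nonneg (d : SturmData e p pd V) (h : MemH2 w w1 w2) {L : ℝ} (hL : 0 ≤ L)
    {R : ℝ → ℝ} {M : ℝ} (cR : Continuous R) (bR : ∀ x, |R x| ≤ M)
    (hR : ∀ x, x ≠ 0 → HasDerivAt R (V x + L * p x + e * L ^ 2 - R x ^ 2 / (p x + 2 * e * L)) x) :
    0 ≤ (∫ x, formA p V w w1 x) + L * (∫ x, formB e p w w1 x) + e * L ^ 2 * ∫ x, ‖w x‖ ^ 2 := by
  have cw := h.continuous_zero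
  have cw1 := h.continuous_one
  have cp := d.cont_p
  have cV := d.cont_V
  have hP : ∀ x, 0.98 ≤ p x + 2 * e * L := fun x => by
    have := mul_nonneg (mul_nonneg zero_le_two d.nonneg) hL
    linarith [d.p_ge x]
  have hP0 : ∀ x, p x + 2 * e * L ≠ 0 := fun x => by linarith [hP x]
  -- The derivative of `R ‖w‖²` has integral zero; subtracting it from the form leaves an integrand
  -- bounded below by a square.
  let f' : ℝ → ℝ := fun x => (V x + L * p x + e * L ^ 2 - R x ^ 2 / (p x + 2 * e * L)) * ‖w x‖ ^ 2
    + R x * (2 * inner ℝ (w x) (w1 x))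
  have hd : ∀ x, x ≠ 0 → HasDerivAt (fun x => R x * ‖w x‖ ^ 2) (f' x) x := fun x hx =>
    (hR x hx).mul (h.hasDerivAt x).norm_sq
  have hi : Integrable fun x => R x * ‖w x‖ ^ 2 := integrable_mul_sq cR bR h.integrable_zero
  have cinner : Continuous fun x => inner ℝ (w x) (w1 x) := cw.inner cw1
  have iI : Integrable fun x => R x * (2 * inner ℝ (w x) (w1 x)) := by
    refine ((h.integrable_zero.add h.integrable_one).const_mul M).mono'
      (by fun_prop) (Eventually.of_forall fun x => ?_)
    rw [norm_mul, norm_mul]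
    have h1 : ‖inner ℝ (w x) (w1 x)‖ ≤ ‖w x‖ * ‖w1 x‖ := norm_inner_le_norm _ _
    refine mul_le_mul (bR x) ?_ (by positivity) ((abs_nonneg _).trans (bR x))
    simp only [Real.norm_ofNat, Pi.add_apply]
    nlinarith [sq_nonneg (‖w x‖ - ‖w1 x‖)]
  have iQ : Integrable fun x => R x ^ 2 / (p x + 2 * e * L) * ‖w x‖ ^ 2 := by
    refine integrable_mul_sq (M := M ^ 2 / 0.98)
      (by exact (cR.pow 2).div (by fun_prop) hP0) (fun x => ?_) h.integrable_zero
    rw [abs_div, abs_pow, abs_of_pos (a := p x + 2 * e * L) (by linarith [hP x])]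
    exact div_le_div₀ (sq_nonneg _) (pow_le_pow_left₀ (abs_nonneg _) (bR x) 2) (by norm_num) (hP x)
  have iA := d.integrable_formA h
  have iB := d.integrable_formB h
  have iS : Integrable fun x => formA p V w w1 x + L * formB e p w w1 x + e * L ^ 2 * ‖w x‖ ^ 2 :=
    (iA.add (iB.const_mul L)).add (h.integrable_zero.const_mul _)
  have iV : Integrable fun x => (V x + L * p x + e * L ^ 2) * ‖w x‖ ^ 2 := by
    have := ((integrable_mul_sq cV d.V_le h.integrable_zero).add
      ((integrable_mul_sq cp d.p_abs h.integrable_zero).const_mul L)).add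
      (h.integrable_zero.const_mul (e * L ^ 2))
    refine this.congr (Eventually.of_forall fun x => ?_)
    simp only [Pi.add_apply]; ring
  have hi' : Integrable f' := by
    refine ((iV.sub iQ).add iI).congr (Eventually.of_forall fun x => ?_)
    simp only [f', Pi.add_apply, Pi.sub_apply]; ring
  have h0 := integral_eq_zero_of_hasDerivAt_off_zero (by fun_prop) hd hi hi'
  have hle : ∫ x, f' x
      ≤ ∫ x, (formA p V w w1 x + L * formB e p w w1 x + e * L ^ 2 * ‖w x‖ ^ 2) := by
    refine integral_mono hi' iS fun x => ?_
    simp only [f', formA, formB]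
    have hp : 0 < p x + 2 * e * L := by linarith [hP x]
    have h1 : R x * inner ℝ (w x) (w1 x) ≤ |R x| * (‖w x‖ * ‖w1 x‖) := by
      refine (le_abs_self _).trans ?_
      rw [abs_mul]
      exact mul_le_mul_of_nonneg_left (norm_inner_le_norm (𝕜 := ℝ) (w x) (w1 x)) (abs_nonneg _)
    have h2 : 0 ≤ (p x + 2 * e * L) * (‖w1 x‖ - |R x| / (p x + 2 * e * L) * ‖w x‖) ^ 2 := by
      positivity
    have h3 : (p x + 2 * e * L) * (‖w1 x‖ - |R x| / (p x + 2 * e * L) * ‖w x‖) ^ 2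
        = (p x + 2 * e * L) * ‖w1 x‖ ^ 2 - 2 * (|R x| * (‖w x‖ * ‖w1 x‖))
          + R x ^ 2 / (p x + 2 * e * L) * ‖w x‖ ^ 2 := by
      rw [← sq_abs (R x)]
      field_simp
      ring
    rw [h3] at h2
    linear_combination h2 + 2 * h1
  rw [h0, integral_add_mul_add_mul iA iB h.integrable_zero] at hle
  exact hle

/-- No real eigenvalue exceeds one for which the Riccati equation has a global solution. -/
theorem re_le (d : SturmData e p pd V) (h : MemH2 w w1 w2) (hw : w ≠ 0) {L : ℝ} (hL : 0 ≤ L)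
    {R : ℝ → ℝ} {M : ℝ} (cR : Continuous R) (bR : ∀ x, |R x| ≤ M)
    (hR : ∀ x, x ≠ 0 → HasDerivAt R (V x + L * p x + e * L ^ 2 - R x ^ 2 / (p x + 2 * e * L)) x)
    {m : ℝ} (heq : ∀ᵐ x : ℝ, Eqn e p pd V m w w1 w2 x) : m ≤ L := by
  by_contra! hm
  have hne : ∀ x, (p x : ℂ) + 2 * e * (m : ℂ) ≠ 0 := fun x h0 => by
    have h1 : p x + 2 * e * m = 0 := by exact_mod_cast h0
    have := mul_nonneg (mul_nonneg zero_le_two d.nonneg) (hL.trans hm.le)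
    linarith [d.p_ge x]
  have hE := d.energy h hne heq
  have hF := d.form_nonneg h hL cR bR hR
  have hB := d.integral_formB_pos h hw
  have hN := h.integral_pos hw
  have hE' : (∫ x, formA p V w w1 x) + m * (∫ x, formB e p w w1 x)
      + e * m ^ 2 * (∫ x, ‖w x‖ ^ 2) = 0 := by exact_mod_cast hE
  -- On `[0, ∞)` the quadratic in the spectral parameter is strictly increasing, so it cannot vanish
  -- at `m` after being nonnegative at `L`.
  have h1 : L * (∫ x, formB e p w w1 x) < m * (∫ x, formB e p w w1 x) :=
    mul_lt_mul_of_pos_right hm hB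
  have h2 : e * L ^ 2 * (∫ x, ‖w x‖ ^ 2) ≤ e * m ^ 2 * (∫ x, ‖w x‖ ^ 2) :=
    mul_le_mul_of_nonneg_right (mul_le_mul_of_nonneg_left (pow_le_pow_left₀ hL hm.le 2) d.nonneg)
      hN.le
  linarith

end SturmData

/-! ### The eigenfunction -/

/-- A positive function with logarithmic derivative at most `-c` near `+∞` is square integrable
there. -/
theorem integrableOn_sq_of_logDeriv_le {v g : ℝ → ℝ} (hv : ∀ x, 0 < v x)
    (hd : ∀ x, HasDerivAt v (g x * v x) x) {c X : ℝ} (hc : 0 < c) (hg : ∀ x, X ≤ x → g x ≤ -c) :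
    IntegrableOn (fun x => v x ^ 2) (Ioi 0) := by
  have hcont : Continuous v := continuous_iff_continuousAt.2 fun x => (hd x).continuousAt
  have he : ∀ x, HasDerivAt (fun x => v x * Real.exp (c * x))
      ((g x + c) * (v x * Real.exp (c * x))) x := fun x => by
    refine ((hd x).mul (((hasDerivAt_id x).const_mul c).exp)).congr_deriv ?_
    simp only [id]; ring
  have hanti : AntitoneOn (fun x => v x * Real.exp (c * x)) (Ici X) := by
    refine antitoneOn_of_deriv_nonpos (convex_Ici X) (by fun_prop)
      (fun x _ => (he x).differentiableAt.differentiableWithinAt) fun x hx => ?_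
    rw [interior_Ici] at hx
    rw [(he x).deriv]
    exact mul_nonpos_of_nonpos_of_nonneg (by linarith [hg x (le_of_lt hx)])
      (mul_pos (hv x) (Real.exp_pos _)).le
  refine integrable_of_isBigO_exp_neg (b := 2 * c) (by linarith) (by fun_prop) ?_
  refine Asymptotics.IsBigO.of_bound ((v X * Real.exp (c * X)) ^ 2) ?_
  filter_upwards [eventually_ge_atTop X] with x hx
  have h1 := hanti (mem_Ici.2 le_rfl) hx hx
  have h2 : (v x * Real.exp (c * x)) ^ 2 ≤ (v X * Real.exp (c * X)) ^ 2 :=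
    pow_le_pow_left₀ (mul_pos (hv x) (Real.exp_pos _)).le h1 2
  rw [Real.norm_of_nonneg (sq_nonneg _), Real.norm_of_nonneg (Real.exp_pos _).le]
  have h3 : v x ^ 2 = (v x * Real.exp (c * x)) ^ 2 * Real.exp (-(2 * c) * x) := by
    rw [mul_pow, ← Real.exp_nat_mul, mul_assoc, ← Real.exp_add]
    simp only [Nat.cast_ofNat]
    rw [show 2 * (c * x) + -(2 * c) * x = 0 by ring, Real.exp_zero, mul_one]
  rw [h3]
  exact mul_le_mul_of_nonneg_right h2 (Real.exp_pos _).le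

theorem integrable_sq_of_logDeriv {v g : ℝ → ℝ} (hv : ∀ x, 0 < v x)
    (hd : ∀ x, HasDerivAt v (g x * v x) x) {c : ℝ} (hc : 0 < c) (hl : ∀ᶠ x in atBot, c ≤ g x)
    (hr : ∀ᶠ x in atTop, g x ≤ -c) : Integrable fun x => v x ^ 2 := by
  obtain ⟨X, hX⟩ := eventually_atTop.1 hr
  obtain ⟨X', hX'⟩ := eventually_atBot.1 hl
  have h1 := integrableOn_sq_of_logDeriv_le hv hd hc hX
  have h2 := integrableOn_sq_of_logDeriv_le (v := fun x => v (-x)) (g := fun x => -g (-x))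
    (X := -X') (fun x => hv _) (fun x => by
      refine ((hd (-x)).comp x (hasDerivAt_neg x)).congr_deriv ?_
      ring) hc (fun x hx => by linarith [hX' (-x) (by linarith)])
  have h3 : IntegrableOn (fun x => v x ^ 2) (Iio 0) := by
    have h2' : IntegrableOn (fun x => v (-x) ^ 2) (Ioi (-0)) := by rwa [neg_zero]
    have := h2'.comp_neg_Iio
    simpa only [neg_neg] using this
  rw [← integrableOn_univ, ← Iio_union_Ici (a := (0 : ℝ))]
  exact h3.union ((integrableOn_Ici_iff_integrableOn_Ioi (by finiteness)).2 h1)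

namespace SturmData

variable {e : ℝ} {p pd V : ℝ → ℝ}

/-- A global solution of the Riccati equation with the right signs at `±∞` gives an
eigenfunction. -/
theorem exists_eigenfunction (d : SturmData e p pd V) {L : ℝ} (hL : 0 ≤ L) (hL' : L ≤ 1)
    {R : ℝ → ℝ} {M c : ℝ} (cR : Continuous R) (bR : ∀ x, |R x| ≤ M)
    (hR : ∀ x, x ≠ 0 → HasDerivAt R (V x + L * p x + e * L ^ 2 - R x ^ 2 / (p x + 2 * e * L)) x)
    (hc : 0 < c) (hl : ∀ᶠ x in atBot, c ≤ R x) (hr : ∀ᶠ x in atTop, R x ≤ -c) :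
    ∃ w w1 w2 : ℝ → ℂ, MemH2 w w1 w2 ∧ w ≠ 0 ∧ ∀ x, Eqn e p pd V L w w1 w2 x := by
  have cp := d.cont_p
  have cV := d.cont_V
  have heL := mul_nonneg d.nonneg hL
  have heL' := mul_le_mul_of_nonneg_left hL' d.nonneg
  have hP : ∀ x, 0.98 ≤ p x + 2 * e * L ∧ p x + 2 * e * L ≤ 2 := fun x => by
    have := d.p_ge x
    have := d.p_le x
    have := d.le
    constructor <;> linarith
  have hP0 : ∀ x, 0 < p x + 2 * e * L := fun x => by linarith [(hP x).1]
  let g : ℝ → ℝ := fun x => R x / (p x + 2 * e * L)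
  have cg : Continuous g := cR.div (by fun_prop) fun x => (hP0 x).ne'
  let v : ℝ → ℝ := fun x => Real.exp (∫ t in (0 : ℝ)..x, g t)
  have hv : ∀ x, 0 < v x := fun x => Real.exp_pos _
  have hd : ∀ x, HasDerivAt v (g x * v x) x := fun x => by
    refine (intervalIntegral.integral_hasDerivAt_right (cg.intervalIntegrable _ _)
      cg.stronglyMeasurable.stronglyMeasurableAtFilter cg.continuousAt).exp.congr_deriv ?_
    rw [mul_comm]
  have cv : Continuous v := continuous_iff_continuousAt.2 fun x => (hd x).continuousAt
  have hgl : ∀ᶠ x in atBot, c / 2 ≤ g x := hl.mono fun x hx =>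
    div_le_div₀ (hc.le.trans hx) hx (hP0 x) (hP x).2
  have hgr : ∀ᶠ x in atTop, g x ≤ -(c / 2) := hr.mono fun x hx => by
    have : c / 2 ≤ -R x / (p x + 2 * e * L) :=
      div_le_div₀ (by linarith) (by linarith) (hP0 x) (hP x).2
    rw [neg_div] at this
    simp only [g]
    linarith
  have hvi := integrable_sq_of_logDeriv hv hd (half_pos hc) hgl hgr
  have hv2 : MemLp v 2 volume := (memLp_two_iff_integrable_sq cv.aestronglyMeasurable).2 hvi
  let v1 : ℝ → ℝ := fun x => g x * v x
  -- The quotient `v''/v` read off from the equation. Its bound holds only off `0`, where `pd` is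
  -- controlled.
  let k : ℝ → ℝ := fun x => (V x + L * p x + e * L ^ 2 - pd x * g x) / (p x + 2 * e * L)
  let v2 : ℝ → ℝ := fun x => k x * v x
  have cv1 : Continuous v1 := cg.mul cv
  have hg' : ∀ x, x ≠ 0 → HasDerivAt g (k x - g x ^ 2) x := fun x hx => by
    have h := (hR x hx).div ((d.deriv_p x hx).add_const (2 * e * L)) (hP0 x).ne'
    refine HasDerivAt.congr_deriv (f := g) h ?_
    have := (hP0 x).ne'
    simp only [k, g]
    generalize p x + 2 * e * L = P at this ⊢
    field_simp
    ring
  have hd1 : ∀ x, x ≠ 0 → HasDerivAt v1 (v2 x) x := fun x hx => by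
    refine ((hg' x hx).mul (hd x)).congr_deriv ?_
    simp only [v2]
    ring
  have gb : ∀ x, |g x| ≤ M / 0.98 := fun x => by
    rw [abs_div, abs_of_pos (hP0 x)]
    exact div_le_div₀ ((abs_nonneg _).trans (bR x)) (bR x) (by norm_num) (hP x).1
  have kb : ∀ᵐ x : ℝ, ‖k x‖ ≤ (5 + M / 0.98) / 0.98 := by
    filter_upwards [compl_mem_ae_iff.2 (measure_singleton (0 : ℝ))] with x hx
    have hM : 0 ≤ M / 0.98 := (abs_nonneg _).trans (gb x)
    rw [Real.norm_eq_abs, abs_div, abs_of_pos (hP0 x)]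
    refine div_le_div₀ (by linarith) ?_ (by norm_num) (hP x).1
    have h1 : |pd x * g x| ≤ 1 * (M / 0.98) := by
      rw [abs_mul]; exact mul_le_mul (d.pd_le x hx) (gb x) (abs_nonneg _) zero_le_one
    have h2 : |L * p x| ≤ 1 * 2 := by
      rw [abs_mul, abs_of_nonneg hL]
      exact mul_le_mul hL' (d.p_abs x) (abs_nonneg _) zero_le_one
    have h3 : |e * L ^ 2| ≤ 1 := by
      rw [abs_of_nonneg (mul_nonneg d.nonneg (sq_nonneg L))]
      nlinarith [d.le]
    have h4 := d.V_le x
    have h5 := abs_sub (V x + L * p x + e * L ^ 2) (pd x * g x)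
    have h6 := abs_add_three (V x) (L * p x) (e * L ^ 2)
    linarith
  have hkm : AEStronglyMeasurable k volume := by
    have := d.meas_pd
    exact (Measurable.div (by fun_prop) (by fun_prop)).aestronglyMeasurable
  have hv1m : MemLp v1 2 volume :=
    hv2.of_le_mul (c := M / 0.98) cv1.aestronglyMeasurable (Eventually.of_forall fun x => by
      rw [norm_mul]; exact mul_le_mul_of_nonneg_right (gb x) (norm_nonneg _))
  have hv2m : MemLp v2 2 volume :=
    hv2.of_le_mul (c := (5 + M / 0.98) / 0.98) (hkm.mul cv.aestronglyMeasurable) (kb.mono fun x hx => by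
      rw [norm_mul]; exact mul_le_mul_of_nonneg_right hx (norm_nonneg _))
  refine ⟨fun x => v x, fun x => v1 x, fun x => v2 x,
    ⟨fun x => (hd x).ofReal_comp, fun x y => ?_, hv2.ofReal, hv1m.ofReal, hv2m.ofReal⟩,
    fun h0 => ?_, fun x => ?_⟩
  · rw [intervalIntegral.integral_ofReal, integral_eq_of_hasDerivAt_off_countable v1 v2
      (countable_singleton 0) cv1.continuousOn (fun z hz => hd1 z hz.2)
      ((hv2m.locallyIntegrable (by norm_num)).integrableOn_isCompact
        isCompact_uIcc).intervalIntegrable]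
    push_cast
    rfl
  · have := congrFun h0 0
    simp only [Pi.zero_apply, Complex.ofReal_eq_zero] at this
    exact (hv 0).ne' this
  · have h1 : (p x + 2 * e * L) * k x = V x + L * p x + e * L ^ 2 - pd x * g x :=
      mul_div_cancel₀ _ (hP0 x).ne'
    have h2 : (p x + 2 * e * L) * v2 x + pd x * v1 x - (V x + L * p x + e * L ^ 2) * v x = 0 := by
      simp only [v2, v1]
      linear_combination v x * h1
    simp only [Eqn]
    exact_mod_cast h2

end SturmData

/-! ### The spectral problem of a kink profile -/

theorem potential_eq (e L T : ℝ) :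
    potential e L T = potential e 0 T + L * stiffness e T + e * L ^ 2 := by
  unfold potential potentialPoly
  ring

theorem continuous_stiffness (e : ℝ) : Continuous (stiffness e) := by
  unfold stiffness; fun_prop

theorem abs_potential_le {e T : ℝ} (he : 0 ≤ e) (he' : e ≤ 1 / 100) (hT : T ^ 2 ≤ 1) :
    |potential e 0 T| ≤ 2 := by
  have hP := stiffness_bounds he he' hT
  have hH := speedSq_bounds he he' hT
  have hi : 0 ≤ (stiffness e T)⁻¹ ∧ (stiffness e T)⁻¹ ≤ 1.1 := by
    have : 0 < stiffness e T := by linarith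
    refine ⟨by positivity, ?_⟩
    rw [inv_le_comm₀ this (by norm_num)]
    exact le_trans (by norm_num) hP.1
  have e1 : potential e 0 T = 2 * T ^ 2 - 1 - e * (1 - 2 * (2 * T ^ 2 - 1) ^ 2
    - 8 * (T ^ 2 * (1 - T ^ 2)) * ((1 + 4 * e * ((1 - T ^ 2) * speedSq e T) + e * (2 * T ^ 2 - 1))
      * (stiffness e T)⁻¹)
    - 4 * (((1 - T ^ 2) * speedSq e T) * (2 * T ^ 2 - 1))) := by
    unfold potential potentialPoly potentialCorr speedSq
    ring
  rw [e1]
  -- Each subexpression is bounded and then abstracted, so that every remaining inequality has low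
  -- degree.
  have hs0 := sq_nonneg T
  generalize T ^ 2 = s at *
  generalize (stiffness e T)⁻¹ = i at *
  generalize speedSq e T = H at *
  have h1 : 0 ≤ (1 - s) * H ∧ (1 - s) * H ≤ 1.1 := by constructor <;> nlinarith
  generalize (1 - s) * H = u at *
  have h2 : 0 ≤ s * (1 - s) ∧ s * (1 - s) ≤ 1 / 4 := by constructor <;> nlinarith [sq_nonneg (s - 1 / 2)]
  generalize s * (1 - s) = r at *
  have h3 : 0 ≤ 1 + 4 * e * u + e * (2 * s - 1) ∧ 1 + 4 * e * u + e * (2 * s - 1) ≤ 1.2 := by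
    have := mul_nonneg he h1.1
    have := mul_nonneg he hs0
    have := mul_le_mul_of_nonneg_left h1.2 he
    have := mul_le_mul_of_nonneg_left hT he
    constructor <;> linarith
  generalize 1 + 4 * e * u + e * (2 * s - 1) = q at *
  have h4 : 0 ≤ q * i ∧ q * i ≤ 2 := ⟨mul_nonneg h3.1 hi.1, by nlinarith⟩
  generalize q * i = k at *
  have h5 : 0 ≤ r * k ∧ r * k ≤ 1 / 2 := ⟨mul_nonneg h2.1 h4.1, by nlinarith⟩
  have h6 : -1.1 ≤ u * (2 * s - 1) ∧ u * (2 * s - 1) ≤ 1.1 := by constructor <;> nlinarith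
  have h7 : 0 ≤ (2 * s - 1) ^ 2 ∧ (2 * s - 1) ^ 2 ≤ 1 := ⟨sq_nonneg _, by nlinarith⟩
  have h8 : |1 - 2 * (2 * s - 1) ^ 2 - 8 * r * k - 4 * (u * (2 * s - 1))| ≤ 20 := by
    rw [mul_assoc, abs_le]; constructor <;> linarith
  have h9 : |e * (1 - 2 * (2 * s - 1) ^ 2 - 8 * r * k - 4 * (u * (2 * s - 1)))| ≤ 1 / 100 * 20 := by
    rw [abs_mul, abs_of_nonneg he]
    exact mul_le_mul he' h8 (abs_nonneg _) (by norm_num)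
  rw [abs_le] at h9 ⊢
  constructor <;> linarith [h9.1, h9.2]

theorem stiffness_ne_zero {e : ℝ} (he : 0 ≤ e) (he' : e ≤ 1 / 100) (y : ℝ) :
    stiffness e (Real.tanh y) ≠ 0 := by
  have := (stiffness_bounds he he' (tanh_sq_le y)).1
  linarith

theorem continuous_speedSq_tanh {e : ℝ} (he : 0 ≤ e) (he' : e ≤ 1 / 100) :
    Continuous fun y => speedSq e (Real.tanh y) := by
  have h1 := continuous_tanh
  unfold speedSq
  exact (by fun_prop : Continuous fun y => 1 + e * Real.tanh y ^ 2).mul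
    (((continuous_stiffness e).comp h1).inv₀ (stiffness_ne_zero he he'))

theorem continuous_potential_tanh {e : ℝ} (he : 0 ≤ e) (he' : e ≤ 1 / 100) (L : ℝ) :
    Continuous fun y => potential e L (Real.tanh y) := by
  have h1 := continuous_tanh
  have h2 : Continuous fun y => stiffness e (Real.tanh y) := (continuous_stiffness e).comp h1
  have h3 : Continuous fun y => (stiffness e (Real.tanh y))⁻¹ :=
    h2.inv₀ (stiffness_ne_zero he he')
  unfold potential potentialPoly potentialCorr
  fun_prop

theorem hasDerivAt_stiffness_tanh (e y : ℝ) :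
    HasDerivAt (fun y => stiffness e (Real.tanh y))
      (8 * e * Real.tanh y * (1 - Real.tanh y ^ 2)) y := by
  have h := (((hasDerivAt_tanh y).pow 2).const_mul (4 * e)).const_add (1 - 2 * e)
  refine h.congr_deriv ?_
  push_cast
  ring

theorem hasDerivAt_speedSq_tanh {e : ℝ} (he : 0 ≤ e) (he' : e ≤ 1 / 100) (y : ℝ) :
    HasDerivAt (fun y => speedSq e (Real.tanh y))
      (2 * damping e (Real.tanh y) * speedSq e (Real.tanh y)) y := by
  have h0 := stiffness_ne_zero he he' y
  have h1 : 1 + e * Real.tanh y ^ 2 ≠ 0 := by positivity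
  have h := (((((hasDerivAt_tanh y).pow 2).const_mul e).const_add 1).mul
    ((hasDerivAt_stiffness_tanh e y).inv h0))
  refine HasDerivAt.congr_deriv (f := fun y => speedSq e (Real.tanh y)) h ?_
  simp only [speedSq, damping, dampingPoly, Pi.inv_apply, Pi.pow_apply]
  push_cast
  field_simp
  ring

namespace KinkProfile

variable {e : ℝ} {Y : ℝ → ℝ}

theorem sturmData (h : KinkProfile e Y) (he : 0 ≤ e) (he' : e ≤ 1 / 100) :
    SturmData e (fun x => stiffness e (Real.tanh (Y x)))
      (fun x => 8 * e * Real.tanh (Y x) * (1 - Real.tanh (Y x) ^ 2) * deriv Y x)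
      (fun x => potential e 0 (Real.tanh (Y x))) where
  nonneg := he
  le := he'
  cont_p := (continuous_stiffness e).comp (continuous_tanh.comp h.continuous)
  cont_V := (continuous_potential_tanh he he' 0).comp h.continuous
  cont_pd := fun x hx => by
    have h1 : Continuous fun x => Real.tanh (Y x) := continuous_tanh.comp h.continuous
    have h2 : Continuous fun x => √(speedSq e (Real.tanh (Y x))) :=
      ((continuous_speedSq_tanh he he').comp h.continuous).sqrt
    have h3 : ContinuousAt (deriv Y) x := by
      rcases lt_or_gt_of_ne hx with hx | hx
      · refine h2.continuousAt.congr ?_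
        filter_upwards [Iio_mem_nhds hx] with z hz using (h.left z hz).deriv.symm
      · refine h2.neg.continuousAt.congr ?_
        filter_upwards [Ioi_mem_nhds hx] with z hz using (h.right z hz).deriv.symm
    fun_prop
  meas_pd := by
    have h1 : Measurable fun x => Real.tanh (Y x) := (continuous_tanh.comp h.continuous).measurable
    have h2 := measurable_deriv Y
    fun_prop
  deriv_p := fun x hx => by
    have hY : HasDerivAt Y (deriv Y x) x := by
      rcases lt_or_gt_of_ne hx with hx | hx
      · exact (h.left x hx).differentiableAt.hasDerivAt
      · exact (h.right x hx).differentiableAt.hasDerivAt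
    exact (hasDerivAt_stiffness_tanh e (Y x)).comp x hY
  p_ge := fun x => (stiffness_bounds he he' (tanh_sq_le _)).1
  p_le := fun x => (stiffness_bounds he he' (tanh_sq_le _)).2
  V_le := fun x => abs_potential_le he he' (tanh_sq_le _)
  pd_le := fun x hx => by
    have h1 : |deriv Y x| ≤ 1.1 := by
      have hH := speedSq_bounds he he' (tanh_sq_le (Y x))
      have : √(speedSq e (Real.tanh (Y x))) ≤ 1.1 :=
        (Real.sqrt_le_left (by norm_num)).2 (hH.2.trans (by norm_num))
      rcases lt_or_gt_of_ne hx with hx | hx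
      · rw [(h.left x hx).deriv, abs_of_nonneg (Real.sqrt_nonneg _)]; exact this
      · rw [(h.right x hx).deriv, abs_neg, abs_of_nonneg (Real.sqrt_nonneg _)]; exact this
    have h2 := abs_tanh_le (Y x)
    have h3 : |1 - Real.tanh (Y x) ^ 2| ≤ 1 := by
      rw [abs_of_pos (one_sub_tanh_sq_pos _)]; linarith [sq_nonneg (Real.tanh (Y x))]
    rw [abs_mul, abs_mul, abs_mul, abs_mul, abs_of_nonneg he, abs_of_nonneg (by norm_num : (0:ℝ) ≤ 8)]
    calc 8 * e * |Real.tanh (Y x)| * |1 - Real.tanh (Y x) ^ 2| * |deriv Y x|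
        ≤ 8 * (1 / 100) * 1 * 1 * 1.1 := by gcongr
      _ ≤ 1 := by norm_num

/-- A solution of the Riccati equation in `y` gives one along the profile. -/
theorem exists_riccati (h : KinkProfile e Y) (he : 0 ≤ e) (he' : e ≤ 1 / 100) {L : ℝ} (hL : 0 ≤ L)
    {Z : ℝ → ℝ} (hZ0 : Z y₀ = 0) (hZ : ∀ y, HasDerivAt Z (potential e L (Real.tanh y)
        + damping e (Real.tanh y) * Z y - quadCoeff e L (Real.tanh y) * Z y ^ 2) y)
    {M : ℝ} (hM : ∀ y, |Z y| ≤ M) (hZl : ∀ y, Real.tanh y ≤ -9 / 10 → 1 / 2 ≤ Z y) :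
    ∃ R : ℝ → ℝ, Continuous R ∧ (∃ M, ∀ x, |R x| ≤ M) ∧
      (∀ x, x ≠ 0 → HasDerivAt R (potential e 0 (Real.tanh (Y x))
        + L * stiffness e (Real.tanh (Y x)) + e * L ^ 2
        - R x ^ 2 / (stiffness e (Real.tanh (Y x)) + 2 * e * L)) x) ∧
      (∀ᶠ x in atBot, 1 / 4 ≤ R x) ∧ ∀ᶠ x in atTop, R x ≤ -(1 / 4) := by
  -- Undoing the scaling cancels the damping term, and the factor `dY/dx = √speedSq` then cancels
  -- the remaining denominator.
  let W : ℝ → ℝ := fun y => Z y / √(speedSq e (Real.tanh y))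
  have hH : ∀ y, 0.9 ≤ speedSq e (Real.tanh y) ∧ speedSq e (Real.tanh y) ≤ 1.1 := fun y =>
    speedSq_bounds he he' (tanh_sq_le y)
  have hs : ∀ y, 0.9 ≤ √(speedSq e (Real.tanh y)) ∧ √(speedSq e (Real.tanh y)) ≤ 1.1 := fun y =>
    ⟨Real.le_sqrt_of_sq_le (le_trans (by norm_num) (hH y).1),
      (Real.sqrt_le_left (by norm_num)).2 ((hH y).2.trans (by norm_num))⟩
  have hspos : ∀ y, 0 < √(speedSq e (Real.tanh y)) := fun y => by linarith [(hs y).1]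
  have hW : ∀ y, HasDerivAt W ((potential e L (Real.tanh y)
      - W y ^ 2 / (stiffness e (Real.tanh y) + 2 * e * L)) / √(speedSq e (Real.tanh y))) y :=
    fun y => by
      have hH0 : speedSq e (Real.tanh y) ≠ 0 := by linarith [(hH y).1]
      have h1 := (hZ y).div ((hasDerivAt_speedSq_tanh he he' y).sqrt hH0) (hspos y).ne'
      refine HasDerivAt.congr_deriv (f := W) h1 ?_
      have hst := stiffness_ne_zero he he' y
      have hst' : stiffness e (Real.tanh y) + 2 * e * L ≠ 0 := by
        have := (stiffness_bounds he he' (tanh_sq_le y)).1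
        have := mul_nonneg he hL
        linarith
      have h1 : 1 + e * Real.tanh y ^ 2 ≠ 0 := by positivity
      have hsq : speedSq e (Real.tanh y) = √(speedSq e (Real.tanh y)) ^ 2 :=
        (Real.sq_sqrt (by linarith [(hH y).1])).symm
      have hq : quadCoeff e L (Real.tanh y) * speedSq e (Real.tanh y)
          = (stiffness e (Real.tanh y) + 2 * e * L)⁻¹ := by
        rw [quadCoeff, speedSq]
        field_simp
      have hq' : quadCoeff e L (Real.tanh y) = (stiffness e (Real.tanh y) + 2 * e * L)⁻¹
          / √(speedSq e (Real.tanh y)) ^ 2 := by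
        rw [eq_div_iff (pow_ne_zero 2 (hspos y).ne'), ← hsq, hq]
      have h2 := (hspos y).ne'
      simp only [W]
      rw [hq']
      generalize √(speedSq e (Real.tanh y)) = r at *
      generalize stiffness e (Real.tanh y) + 2 * e * L = P at *
      rw [hsq]
      field_simp
      ring
  have cW : Continuous W := continuous_iff_continuousAt.2 fun y => (hW y).continuousAt
  have hW0 : W (Y 0) = 0 := by simp [W, h.zero, hZ0]
  have bW : ∀ y, |W y| ≤ M / 0.9 := fun y => by
    rw [abs_div, abs_of_pos (hspos y)]
    exact div_le_div₀ ((abs_nonneg _).trans (hM y)) (hM y) (by norm_num) (hs y).1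
  have hWl : ∀ y, Real.tanh y ≤ -9 / 10 → 1 / 4 ≤ W y := fun y hy => by
    simp only [W]
    rw [le_div_iff₀ (hspos y)]
    linarith [hZl y hy, (hs y).2]
  -- Reversing `x` changes the sign of a logarithmic derivative; `W y₀ = 0` makes the sign change at
  -- `0` continuous.
  let R : ℝ → ℝ := fun x => W (Y (min x 0)) - W (Y (max x 0))
  have hl : ∀ x ≤ 0, R x = W (Y x) := fun x hx => by
    simp only [R]; rw [min_eq_left hx, max_eq_right hx, hW0, sub_zero]
  have hr : ∀ x ≥ 0, R x = -W (Y x) := fun x hx => by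
    simp only [R]; rw [min_eq_right hx, max_eq_left hx, hW0, zero_sub]
  have cY := h.continuous
  refine ⟨R, by fun_prop, ⟨M / 0.9, fun x => ?_⟩, fun x hx => ?_, ?_, ?_⟩
  · rcases le_total x 0 with hx | hx
    · rw [hl x hx]; exact bW _
    · rw [hr x hx, abs_neg]; exact bW _
  · rw [← potential_eq]
    have h0 := (hspos (Y x)).ne'
    rcases lt_or_gt_of_ne hx with hx | hx
    · rw [hl x hx.le]
      have h1 := (hW (Y x)).comp x (h.left x hx)
      rw [div_mul_cancel₀ _ h0] at h1
      refine h1.congr_of_eventuallyEq ?_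
      filter_upwards [Iio_mem_nhds hx] with z hz using hl z (le_of_lt hz)
    · rw [hr x hx.le, neg_sq]
      have h1 := ((hW (Y x)).comp x (h.right x hx)).neg
      rw [mul_neg, div_mul_cancel₀ _ h0, neg_neg] at h1
      refine h1.congr_of_eventuallyEq ?_
      filter_upwards [Ioi_mem_nhds hx] with z hz using hr z (le_of_lt hz)
  · filter_upwards [h.tendsto_atBot.eventually_lt_const (by norm_num : (-1 : ℝ) < -9 / 10),
      eventually_le_atBot 0] with x hx hx'
    rw [hl x hx']; exact hWl _ hx.le
  · filter_upwards [h.tendsto_atTop.eventually_lt_const (by norm_num : (-1 : ℝ) < -9 / 10),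
      eventually_ge_atTop 0] with x hx hx'
    rw [hr x hx']; exact neg_le_neg (hWl _ hx.le)

end KinkProfile

/-- The largest eigenvalue of the linearization about any kink. -/
theorem IsThreePiKink.isLargestEigenvalue {a : ℝ} {φ : ℝ → ℝ} (h : IsThreePiKink a φ)
    (ha : a ^ 2 / 12 ≤ 1 / 100) {L : ℝ} (hL : 0 ≤ L) (hL' : L ≤ 1) {Z : ℝ → ℝ} (hZ0 : Z y₀ = 0)
    (hZ : ∀ y, HasDerivAt Z (potential (a ^ 2 / 12) L (Real.tanh y)
        + damping (a ^ 2 / 12) (Real.tanh y) * Z y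
        - quadCoeff (a ^ 2 / 12) L (Real.tanh y) * Z y ^ 2) y)
    {M : ℝ} (hM : ∀ y, |Z y| ≤ M) (hZl : ∀ y, Real.tanh y ≤ -9 / 10 → 1 / 2 ≤ Z y) :
    IsLargestEigenvalue a φ L := by
  have he : 0 ≤ a ^ 2 / 12 := by positivity
  obtain ⟨Y, hY, hlin⟩ := h.exists_profile ha
  have d := hY.sturmData he ha
  obtain ⟨R, cR, ⟨M', bR⟩, hR, hl, hr⟩ := hY.exists_riccati he ha hL hZ0 hZ hM hZl
  have hae : ∀ᵐ x : ℝ, x ≠ 0 := compl_mem_ae_iff.2 (measure_singleton (0 : ℝ))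
  have hiff : ∀ (s : ℂ) (w w1 w2 : ℝ → ℂ) (x : ℝ), x ≠ 0 →
      (linearization a (theta x) s (φ x : ℝ) (deriv φ x : ℝ) (deriv (deriv φ) x : ℝ)
        (w x) (w1 x) (w2 x) = 0 ↔ SturmData.Eqn (a ^ 2 / 12)
          (fun x => stiffness (a ^ 2 / 12) (Real.tanh (Y x)))
          (fun x => 8 * (a ^ 2 / 12) * Real.tanh (Y x) * (1 - Real.tanh (Y x) ^ 2) * deriv Y x)
          (fun x => potential (a ^ 2 / 12) 0 (Real.tanh (Y x))) (s ^ 2) w w1 w2 x) :=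
    fun s w w1 w2 x hx => by
      rw [hlin x hx, SturmData.Eqn]
  constructor
  · obtain ⟨w, w1, w2, hw, hw0, hEq⟩ := d.exists_eigenfunction hL hL' cR bR hR (by norm_num) hl hr
    refine ⟨((√L : ℝ) : ℂ), ?_, w, w1, w2, hw, hw0, ?_⟩
    · rw [← Complex.ofReal_pow, Real.sq_sqrt hL]
    · filter_upwards [hae] with x hx
      rw [hiff _ _ _ _ x hx, ← Complex.ofReal_pow, Real.sq_sqrt hL]
      exact hEq x
  · rintro m ⟨s, hs, w, w1, w2, hw, hw0, hEq⟩
    have hEq' := hEq.and hae |>.mono fun x hx => (hiff s w w1 w2 x hx.2).1 hx.1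
    rw [hs] at hEq'
    have him := d.im_eq_zero hw hw0 hEq'
    refine ⟨him, ?_⟩
    have hm : ((m.re : ℝ) : ℂ) = m := Complex.ext (by simp) (by simp [him])
    rw [← hm] at hEq'
    exact d.re_le hw hw0 hL cR bR hR hEq'

/-! ### Existence of the kink -/

theorem sqrt_speedSq_bounds {e : ℝ} (he : 0 ≤ e) (he' : e ≤ 1 / 100) (y : ℝ) :
    0.9 ≤ √(speedSq e (Real.tanh y)) ∧ √(speedSq e (Real.tanh y)) ≤ 1.1 := by
  have hH := speedSq_bounds he he' (tanh_sq_le y)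
  exact ⟨Real.le_sqrt_of_sq_le (le_trans (by norm_num) hH.1),
    (Real.sqrt_le_left (by norm_num)).2 (hH.2.trans (by norm_num))⟩

theorem monotone_sub_mul {f f' : ℝ → ℝ} (hf : ∀ x, HasDerivAt f (f' x) x) {c : ℝ}
    (hc : ∀ x, c ≤ f' x) : Monotone fun x => f x - c * x := by
  have h : ∀ x, HasDerivAt (fun x => f x - c * x) (f' x - c) x := fun x => by
    have h := (hf x).sub ((hasDerivAt_id x).const_mul c)
    rw [mul_one] at h
    exact h
  refine monotone_of_deriv_nonneg (fun x => (h x).differentiableAt) fun x => ?_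
  rw [(h x).deriv]
  linarith [hc x]

/-- A scalar autonomous equation with speed bounded away from `0` and `∞` has a global solution. -/
theorem exists_solution_of_speed {s : ℝ → ℝ} (hs : Continuous s) {m M : ℝ} (hm : 0 < m)
    (hsm : ∀ y, m ≤ s y) (hsM : ∀ y, s y ≤ M) (y : ℝ) :
    ∃ Y : ℝ → ℝ, Y 0 = y ∧ ∀ x, HasDerivAt Y (s (Y x)) x := by
  have hpos : ∀ y, 0 < s y := fun y => hm.trans_le (hsm y)
  have hM : 0 < M := (hpos 0).trans_le (hsM 0)
  -- The travel time from `y` to `z`. It is a bijection of the line because the speed is bounded,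
  -- and its inverse is the solution.
  let X : ℝ → ℝ := fun z => ∫ t in y..z, (s t)⁻¹
  have hc : Continuous fun t => (s t)⁻¹ := hs.inv₀ fun t => (hpos t).ne'
  have hX : ∀ z, HasDerivAt X (s z)⁻¹ z := fun z =>
    intervalIntegral.integral_hasDerivAt_right (hc.intervalIntegrable _ _)
      hc.stronglyMeasurable.stronglyMeasurableAtFilter hc.continuousAt
  have hmono : StrictMono X := strictMono_of_deriv_pos fun z => by
    rw [(hX z).deriv]; exact inv_pos.2 (hpos z)
  have hlow := monotone_sub_mul hX (c := M⁻¹) fun z => inv_anti₀ (hpos z) (hsM z)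
  have hM' : 0 < M⁻¹ := inv_pos.2 hM
  have htop : Tendsto X atTop atTop := by
    refine tendsto_atTop_mono' atTop (f₁ := fun z => X 0 + M⁻¹ * z) ?_
      (tendsto_atTop_add_const_left _ _ (tendsto_id.const_mul_atTop hM'))
    filter_upwards [eventually_ge_atTop 0] with z hz
    have := hlow hz
    simp only [mul_zero, sub_zero] at this
    linarith
  have hbot : Tendsto X atBot atBot := by
    refine tendsto_atBot_mono' atBot (f₁ := fun z => X 0 + M⁻¹ * z) ?_
      (tendsto_atBot_add_const_left _ _ (tendsto_id.const_mul_atBot hM'))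
    filter_upwards [eventually_le_atBot 0] with z hz
    have := hlow hz
    simp only [mul_zero, sub_zero] at this
    linarith
  have hcX : Continuous X := continuous_iff_continuousAt.2 fun z => (hX z).continuousAt
  let I := hmono.orderIsoOfSurjective X (hcX.surjective htop hbot)
  have hI : ∀ z, I z = X z := fun z => rfl
  refine ⟨I.symm, ?_, fun x => ?_⟩
  · rw [OrderIso.symm_apply_eq, hI]
    simp [X]
  · have h := HasDerivAt.of_local_left_inverse (f := X) (g := I.symm) (a := x)
      I.symm.continuous.continuousAt (hX _) (inv_ne_zero (hpos _).ne')
      (Eventually.of_forall fun z => I.apply_symm_apply z)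
    rwa [inv_inv] at h

/-- The static profile in the coordinate `y`. -/
def pulse (y : ℝ) : ℝ := 4 * Real.arctan (Real.exp y)

theorem pulse_mem (y : ℝ) : 0 < pulse y ∧ pulse y < 2 * Real.pi := by
  have h1 : 0 < Real.arctan (Real.exp y) := Real.arctan_pos.2 (Real.exp_pos y)
  have h2 := Real.arctan_lt_pi_div_two (Real.exp y)
  unfold pulse
  constructor <;> linarith

theorem cos_half_pulse (y : ℝ) : Real.cos (pulse y / 2) = -Real.tanh y := by
  have h := tanh_log_tan (pulse_mem y)
  rw [show pulse y / 4 = Real.arctan (Real.exp y) by rw [pulse]; ring, Real.tan_arctan,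
    Real.log_exp] at h
  rw [h, neg_neg]

theorem sin_half_pulse (y : ℝ) : Real.sin (pulse y / 2) = (Real.cosh y)⁻¹ := by
  have hm := pulse_mem y
  have h1 : 0 < Real.sin (pulse y / 2) := Real.sin_pos_of_pos_of_lt_pi (by linarith) (by linarith)
  have hc := Real.cosh_pos y
  refine (sq_eq_sq₀ h1.le (by positivity)).1 ?_
  rw [Real.sin_sq, cos_half_pulse, Real.tanh_eq_sinh_div_cosh]
  have := Real.cosh_sq y
  field_simp
  linarith

theorem cos_pulse (y : ℝ) : Real.cos (pulse y) = 2 * Real.tanh y ^ 2 - 1 := by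
  rw [show pulse y = 2 * (pulse y / 2) by ring, Real.cos_two_mul, cos_half_pulse, neg_sq]

theorem sin_pulse (y : ℝ) : Real.sin (pulse y) = -2 * Real.tanh y * (Real.cosh y)⁻¹ := by
  rw [show pulse y = 2 * (pulse y / 2) by ring, Real.sin_two_mul, cos_half_pulse, sin_half_pulse]
  ring

theorem pulse_y₀ : pulse y₀ = 3 * Real.pi / 2 := by
  have hm := pulse_mem y₀
  have h : Real.cos (pulse y₀ / 2) = Real.cos (3 * Real.pi / 4) := by
    rw [cos_half_pulse, tanh_y₀, show 3 * Real.pi / 4 = Real.pi - Real.pi / 4 by ring,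
      Real.cos_pi_sub, Real.cos_pi_div_four]
  have := Real.injOn_cos ⟨by linarith, by linarith⟩ ⟨by positivity, by linarith [Real.pi_pos]⟩ h
  linarith

theorem hasDerivAt_pulse (y : ℝ) : HasDerivAt pulse (2 * (Real.cosh y)⁻¹) y := by
  have h := ((Real.hasDerivAt_exp y).arctan).const_mul 4
  refine HasDerivAt.congr_deriv (f := pulse) h ?_
  rw [Real.cosh_eq, Real.exp_neg]
  have := Real.exp_pos y
  field_simp
  ring

theorem inv_cosh_le (y : ℝ) : (Real.cosh y)⁻¹ ≤ 2 * Real.exp y := by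
  rw [inv_le_comm₀ (Real.cosh_pos y) (by positivity), Real.cosh_eq, mul_inv, ← Real.exp_neg]
  have := Real.exp_pos y
  linarith

theorem abs_damping_le {e T : ℝ} (he : 0 ≤ e) (he' : e ≤ 1 / 100) (hT : T ^ 2 ≤ 1) :
    |damping e T| ≤ 1 := by
  have hP := stiffness_bounds he he' hT
  have hT' : |T| ≤ 1 := (sq_le_one_iff_abs_le_one T).1 hT
  have h1 : |1 - T ^ 2| ≤ 1 := abs_le.2 ⟨by linarith, by linarith [sq_nonneg T]⟩
  have h2 : |(1 + e * T ^ 2)⁻¹| ≤ 1 := by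
    have : 0 ≤ e * T ^ 2 := by positivity
    rw [abs_inv, abs_of_pos (by linarith)]
    exact inv_le_one_of_one_le₀ (by linarith)
  have h3 : |(stiffness e T)⁻¹| ≤ 2 := by
    rw [abs_inv, abs_of_pos (by linarith), inv_le_comm₀ (by linarith) (by norm_num)]
    linarith
  have h4 : |T * (1 + e * T ^ 2)⁻¹ - 4 * T * (stiffness e T)⁻¹| ≤ 1 * 1 + 4 * 1 * 2 := by
    refine (abs_sub _ _).trans (add_le_add ?_ ?_)
    · rw [abs_mul]; gcongr
    · rw [abs_mul, abs_mul, abs_of_pos (by norm_num : (0 : ℝ) < 4)]; gcongr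
  unfold damping dampingPoly
  rw [abs_mul, abs_mul, abs_of_nonneg he]
  calc e * (|1 - T ^ 2| * |T * (1 + e * T ^ 2)⁻¹ - 4 * T * (stiffness e T)⁻¹|)
      ≤ 1 / 100 * (1 * (1 * 1 + 4 * 1 * 2)) := by gcongr
    _ ≤ 1 := by norm_num

theorem memLp_two_of_abs_le_exp {f : ℝ → ℝ} (hf : AEStronglyMeasurable f volume) {K c : ℝ}
    (hc : 0 < c) (hb : ∀ᵐ x : ℝ, |f x| ≤ K * Real.exp (-c * |x|)) : MemLp f 2 volume := by
  have hcont : Continuous fun x : ℝ => Real.exp (-c * |x|) := by fun_prop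
  have h2 : Integrable fun x : ℝ => Real.exp (-c * |x|) ^ 2 := by
    have h3 : IntegrableOn (fun x : ℝ => Real.exp (-c * |x|) ^ 2) (Ioi 0) := by
      refine (integrableOn_exp_mul_Ioi (a := -(2 * c)) (by linarith) 0).congr_fun (fun x hx => ?_)
        measurableSet_Ioi
      simp only
      rw [abs_of_pos (mem_Ioi.1 hx), ← Real.exp_nat_mul]
      congr 1; push_cast; ring
    have h4 : IntegrableOn (fun x : ℝ => Real.exp (-c * |x|) ^ 2) (Iio 0) := by
      have h3' : IntegrableOn (fun x : ℝ => Real.exp (-c * |x|) ^ 2) (Ioi (-0)) := by rwa [neg_zero]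
      simpa only [abs_neg] using h3'.comp_neg_Iio
    rw [← integrableOn_univ, ← Iio_union_Ici (a := (0 : ℝ))]
    exact h4.union ((integrableOn_Ici_iff_integrableOn_Ioi (by finiteness)).2 h3)
  refine ((memLp_two_iff_integrable_sq hcont.aestronglyMeasurable).2 h2).of_le_mul (c := K) hf
    (hb.mono fun x hx => ?_)
  rw [Real.norm_eq_abs, Real.norm_of_nonneg (Real.exp_pos _).le]
  exact hx

/-- The equation for `Y` started at `y₀` gives the left half as `pulse ∘ Y`. Its value `3π/2` at `0`
is fixed by the reflection, which also preserves the slope, so the reflected right half joins it in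
a C¹ way. Decay at the ends follows from the linear bound on `Y`. -/
theorem exists_kink {a : ℝ} (ha : a ^ 2 / 12 ≤ 1 / 100) : ∃ φ : ℝ → ℝ, IsThreePiKink a φ := by
  have he : 0 ≤ a ^ 2 / 12 := by positivity
  set e := a ^ 2 / 12 with hedef
  have hsb := sqrt_speedSq_bounds he ha
  have hspeed := continuous_speedSq_tanh he ha
  obtain ⟨Y, hY0, hY⟩ := exists_solution_of_speed (s := fun y => √(speedSq e (Real.tanh y)))
    hspeed.sqrt (by norm_num : (0 : ℝ) < 0.9) (fun y => (hsb y).1) (fun y => (hsb y).2) y₀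
  have hgrow : ∀ x ≤ 0, Y x ≤ y₀ + 0.9 * x := fun x hx => by
    have := monotone_sub_mul hY (fun z => (hsb (Y z)).1) hx
    simp only [hY0, mul_zero, sub_zero] at this
    linarith
  have cY : Continuous Y := continuous_iff_continuousAt.2 fun x => (hY x).continuousAt
  let f : ℝ → ℝ := fun x => pulse (Y x)
  let f1 : ℝ → ℝ := fun x => 2 * (Real.cosh (Y x))⁻¹ * √(speedSq e (Real.tanh (Y x)))
  let f2 : ℝ → ℝ := fun x => 2 * (Real.cosh (Y x))⁻¹ * speedSq e (Real.tanh (Y x))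
    * (damping e (Real.tanh (Y x)) - Real.tanh (Y x))
  have hf : ∀ x, HasDerivAt f (f1 x) x := fun x => (hasDerivAt_pulse (Y x)).comp x (hY x)
  have hf1 : ∀ x, HasDerivAt f1 (f2 x) x := fun x => by
    have hH := speedSq_bounds he ha (tanh_sq_le (Y x))
    have hH0 : speedSq e (Real.tanh (Y x)) ≠ 0 := by linarith
    have hc := (Real.cosh_pos (Y x)).ne'
    have h1 := ((((Real.hasDerivAt_cosh (Y x)).inv hc).const_mul 2).mul
      ((hasDerivAt_speedSq_tanh he ha (Y x)).sqrt hH0)).comp x (hY x)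
    refine HasDerivAt.congr_deriv (f := f1) h1 ?_
    have hsq : speedSq e (Real.tanh (Y x)) = √(speedSq e (Real.tanh (Y x))) ^ 2 :=
      (Real.sq_sqrt (by linarith)).symm
    have hr : √(speedSq e (Real.tanh (Y x))) ≠ 0 := by linarith [(hsb (Y x)).1]
    simp only [f2, Pi.inv_apply]
    have ht : Real.sinh (Y x) = Real.tanh (Y x) * Real.cosh (Y x) := by
      rw [Real.tanh_eq_sinh_div_cosh]; field_simp
    rw [ht]
    generalize √(speedSq e (Real.tanh (Y x))) = r at *
    rw [hsq]
    field_simp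
    ring
  have cf1 : Continuous f1 := continuous_iff_continuousAt.2 fun x => (hf1 x).continuousAt
  have hf0 : f 0 = 3 * Real.pi / 2 := by simp only [f]; rw [hY0, pulse_y₀]
  have hexp : ∀ x, (Real.cosh (Y (-|x|)))⁻¹ ≤ 2 * Real.exp y₀ * Real.exp (-0.9 * |x|) := fun x => by
    refine (inv_cosh_le _).trans ?_
    rw [mul_assoc, ← Real.exp_add]
    have := hgrow (-|x|) (by simp)
    exact mul_le_mul_of_nonneg_left (Real.exp_le_exp.2 (by linarith)) zero_le_two
  let φ : ℝ → ℝ := fun x => f (min x 0) - f (min (-x) 0) + 3 * Real.pi / 2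
  have hl : ∀ x ≤ 0, φ x = f x := fun x hx => by
    simp only [φ]; rw [min_eq_left hx, min_eq_right (by linarith), hf0]; ring
  have hr : ∀ x ≥ 0, φ x = 3 * Real.pi - f (-x) := fun x hx => by
    simp only [φ]; rw [min_eq_right hx, min_eq_left (by linarith), hf0]; ring
  have hfr : ∀ x, HasDerivAt (fun x => 3 * Real.pi - f (-x)) (f1 (-x)) x := fun x => by
    have := ((hf (-x)).comp x (hasDerivAt_neg x)).const_sub (3 * Real.pi)
    simpa using this
  have hφ : ∀ x, HasDerivAt φ (f1 (-|x|)) x := fun x => by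
    rcases lt_trichotomy x 0 with hx | rfl | hx
    · rw [abs_of_neg hx, neg_neg]
      refine (hf x).congr_of_eventuallyEq ?_
      filter_upwards [Iio_mem_nhds hx] with z hz using hl z (le_of_lt hz)
    · rw [abs_zero, ← hasDerivWithinAt_univ, ← Iic_union_Ici (a := (0 : ℝ))]
      refine HasDerivWithinAt.union ?_ ?_
      · rw [neg_zero]
        exact (hf 0).hasDerivWithinAt.congr (fun z hz => hl z hz) (hl 0 le_rfl)
      · exact (hfr 0).hasDerivWithinAt.congr (fun z hz => hr z hz) (hr 0 le_rfl)
    · rw [abs_of_pos hx]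
      refine (hfr x).congr_of_eventuallyEq ?_
      filter_upwards [Ioi_mem_nhds hx] with z hz using hr z (le_of_lt hz)
  have hd : deriv φ = fun x => f1 (-|x|) := funext fun x => (hφ x).deriv
  have hdl : ∀ x < 0, HasDerivAt (deriv φ) (f2 x) x := fun x hx => by
    refine (hf1 x).congr_of_eventuallyEq ?_
    filter_upwards [Iio_mem_nhds hx] with z hz
    rw [hd]; simp only; rw [abs_of_neg hz, neg_neg]
  have hdr : ∀ x > 0, HasDerivAt (deriv φ) (-f2 (-x)) x := fun x hx => by
    have h1 := (hf1 (-x)).comp x (hasDerivAt_neg x)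
    rw [mul_neg, mul_one] at h1
    refine h1.congr_of_eventuallyEq ?_
    filter_upwards [Ioi_mem_nhds hx] with z hz
    rw [hd]; simp only [Function.comp_apply]; rw [abs_of_pos hz]
  have hstat : ∀ x, f2 x - (Real.sin (f x) - e * (2 * f2 x * Real.cos (f x)
      - f1 x ^ 2 * Real.sin (f x) - Real.cos (f x) * Real.sin (f x))) = 0 := fun x => by
    have hst := stiffness_ne_zero he ha (Y x)
    have hQ : 1 + e * Real.tanh (Y x) ^ 2 ≠ 0 := by positivity
    have hc := (Real.cosh_pos (Y x)).ne'
    have hH := speedSq_bounds he ha (tanh_sq_le (Y x))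
    have hcosh : (Real.cosh (Y x))⁻¹ ^ 2 = 1 - Real.tanh (Y x) ^ 2 := by
      rw [← sin_half_pulse, Real.sin_sq, cos_half_pulse, neg_sq]
    have hf1sq : f1 x ^ 2 = 4 * (1 - Real.tanh (Y x) ^ 2) * speedSq e (Real.tanh (Y x)) := by
      simp only [f1]
      rw [mul_pow, mul_pow, hcosh, Real.sq_sqrt (by linarith)]
      ring
    rw [hf1sq]
    simp only [f, f2]
    rw [cos_pulse, sin_pulse]
    have e1 : stiffness e (Real.tanh (Y x)) * speedSq e (Real.tanh (Y x))
        = 1 + e * Real.tanh (Y x) ^ 2 := by rw [speedSq]; field_simp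
    -- The static equation after cancelling the common factor `2 / cosh`.
    have e2 : stiffness e (Real.tanh (Y x)) * (speedSq e (Real.tanh (Y x))
          * (damping e (Real.tanh (Y x)) - Real.tanh (Y x)))
        = -Real.tanh (Y x) * (1 + 4 * e * (1 - Real.tanh (Y x) ^ 2) * speedSq e (Real.tanh (Y x))
          + e * (2 * Real.tanh (Y x) ^ 2 - 1)) := by
      rw [← mul_assoc, e1, damping, dampingPoly, speedSq]
      field_simp
      ring
    rw [stiffness] at e2
    linear_combination 2 * (Real.cosh (Y x))⁻¹ * e2
  have hstat_neg : ∀ x, -f2 x - (-Real.sin (f x) - e * (2 * -f2 x * Real.cos (f x)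
      - f1 x ^ 2 * -Real.sin (f x) - Real.cos (f x) * -Real.sin (f x))) = 0 := fun x => by
    linear_combination -hstat x
  have hlim : Tendsto f atBot (𝓝 0) := by
    have hYbot : Tendsto Y atBot atBot := by
      refine tendsto_atBot_mono' atBot (f₁ := fun x => y₀ + 0.9 * x) ?_
        (tendsto_atBot_add_const_left _ _ (tendsto_id.const_mul_atBot (by norm_num : (0 : ℝ) < 0.9)))
      filter_upwards [eventually_le_atBot 0] with x hx using hgrow x hx
    have h1 := ((Real.continuous_arctan.tendsto 0).comp
      (Real.tendsto_exp_atBot.comp hYbot)).const_mul 4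
    have h2 : Tendsto (fun x => 4 * Real.arctan (Real.exp (Y x))) atBot (𝓝 0) := by simpa using h1
    exact h2
  refine ⟨φ, ⟨fun x => (hφ x).differentiableAt, ?_, fun x hx => ?_, fun x hx => ?_, ?_, ?_, ?_, ?_⟩⟩
  · rw [hd]; fun_prop
  · rcases lt_or_gt_of_ne hx with hx | hx
    · exact (hdl x hx).differentiableAt
    · exact (hdr x hx).differentiableAt
  · rw [staticResidual, ← hedef]
    rcases lt_or_gt_of_ne hx with hx | hx
    · rw [(hdl x hx).deriv, hd, hl x hx.le, theta, if_neg hx.not_gt, add_zero]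
      simp only
      rw [abs_of_neg hx, neg_neg]
      exact hstat x
    · have hx' : ¬ 0 < -x := by linarith
      rw [(hdr x hx).deriv, hd, hr x hx.le, IsThreePiKink.sin_reflect _ hx.ne',
        IsThreePiKink.cos_reflect _ hx.ne', theta, if_neg hx', add_zero]
      simp only
      rw [abs_of_pos hx]
      exact hstat_neg (-x)
  · refine memLp_two_of_abs_le_exp (by rw [hd]; exact (by fun_prop : Continuous fun x => f1 (-|x|)).aestronglyMeasurable)
      (K := 2 * (2 * Real.exp y₀) * 1.1) (c := 0.9) (by norm_num) (Eventually.of_forall fun x => ?_)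
    rw [hd]
    simp only [f1]
    rw [abs_mul, abs_mul, abs_two, abs_of_pos (inv_pos.2 (Real.cosh_pos _)),
      abs_of_nonneg (Real.sqrt_nonneg _)]
    calc 2 * (Real.cosh (Y (-|x|)))⁻¹ * √(speedSq e (Real.tanh (Y (-|x|))))
        ≤ 2 * (2 * Real.exp y₀ * Real.exp (-0.9 * |x|)) * 1.1 := by
          gcongr
          · exact hexp x
          · exact (hsb _).2
      _ = 2 * (2 * Real.exp y₀) * 1.1 * Real.exp (-0.9 * |x|) := by ring
  · refine memLp_two_of_abs_le_exp (measurable_deriv _).aestronglyMeasurable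
      (K := 2 * (2 * Real.exp y₀) * 1.1 * 2) (c := 0.9) (by norm_num) ?_
    filter_upwards [compl_mem_ae_iff.2 (measure_singleton (0 : ℝ))] with x hx
    have h1 : |deriv (deriv φ) x| = |f2 (-|x|)| := by
      rcases lt_or_gt_of_ne (show x ≠ 0 from hx) with hx | hx
      · rw [(hdl x hx).deriv, abs_of_neg hx, neg_neg]
      · rw [(hdr x hx).deriv, abs_of_pos hx, abs_neg]
    rw [h1]
    simp only [f2]
    have hH := speedSq_bounds he ha (tanh_sq_le (Y (-|x|)))
    have h2 : |damping e (Real.tanh (Y (-|x|))) - Real.tanh (Y (-|x|))| ≤ 2 := by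
      refine (abs_sub _ _).trans ?_
      linarith [abs_damping_le he ha (tanh_sq_le (Y (-|x|))), abs_tanh_le (Y (-|x|))]
    rw [abs_mul, abs_mul, abs_mul, abs_two, abs_of_pos (inv_pos.2 (Real.cosh_pos _)),
      abs_of_pos (a := speedSq e (Real.tanh (Y (-|x|)))) (by linarith)]
    calc 2 * (Real.cosh (Y (-|x|)))⁻¹ * speedSq e (Real.tanh (Y (-|x|)))
          * |damping e (Real.tanh (Y (-|x|))) - Real.tanh (Y (-|x|))|
        ≤ 2 * (2 * Real.exp y₀ * Real.exp (-0.9 * |x|)) * 1.1 * 2 := by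
          gcongr
          · linarith
          · exact hexp x
          · exact hH.2
      _ = 2 * (2 * Real.exp y₀) * 1.1 * 2 * Real.exp (-0.9 * |x|) := by ring
  · refine hlim.congr' ?_
    filter_upwards [eventually_le_atBot 0] with x hx using (hl x hx).symm
  · have h1 := (hlim.comp tendsto_neg_atTop_atBot).const_sub (3 * Real.pi)
    rw [sub_zero] at h1
    refine h1.congr' ?_
    filter_upwards [eventually_ge_atTop 0] with x hx using (hr x hx).symm

end LatticeKink

end

/-! ### From `e` back to the lattice spacing -/

theorem lemma4p6 :
    ∃ a₀ : ℝ, 0 < a₀ ∧ ∃ C : ℝ, ∃ Λ : ℝ → ℝ,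
      (∀ a ∈ Set.Ico (0 : ℝ) a₀,
        (∃ φ : ℝ → ℝ, LatticeKink.IsThreePiKink a φ) ∧
        (∀ φ : ℝ → ℝ, LatticeKink.IsThreePiKink a φ →
          LatticeKink.IsLargestEigenvalue a φ (Λ a)) ∧
        0 < Λ a ∧
        |Λ a - ((√5 - 1) / 4 + 7 / (48 * √5) * a ^ 2)| ≤ C * a ^ 4) ∧
      StrictMonoOn Λ (Set.Ico 0 a₀) := by
  obtain ⟨e₀, he₀, K, L, hmono, hL⟩ := LatticeKink.exists_branch
  have hm : 0 < min e₀ (1 / 100) := lt_min he₀ (by norm_num)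
  have hin : ∀ a ∈ Set.Ico (0 : ℝ) (√(12 * min e₀ (1 / 100))),
      a ^ 2 / 12 ∈ Set.Ico 0 e₀ ∧ a ^ 2 / 12 ≤ 1 / 100 := fun a ha => by
    have h1 := (Real.lt_sqrt ha.1).1 ha.2
    have h2 := min_le_left e₀ (1 / 100)
    have h3 := min_le_right e₀ (1 / 100)
    exact ⟨⟨by positivity, by linarith⟩, by linarith⟩
  -- The radius ensures that `a² / 12` is below both `e₀`, needed for the branch, and `1/100`,
  -- needed for the kink estimates; `K e² = (K / 144) a⁴`.
  refine ⟨√(12 * min e₀ (1 / 100)), by positivity, K / 144, fun a => L (a ^ 2 / 12),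
    fun a ha => ?_, fun a ha b hb hab => ?_⟩
  · obtain ⟨h1, h2⟩ := hin a ha
    obtain ⟨hbound, hlow, hup, Z, hZ0, hZ, ⟨M, hM⟩, hZl⟩ := hL _ h1
    refine ⟨LatticeKink.exists_kink h2, fun φ hφ => ?_, by linarith, ?_⟩
    · exact hφ.isLargestEigenvalue h2 (by linarith) (by linarith) hZ0 hZ hM hZl
    · have e1 : (√5 - 1) / 4 + 7 / (48 * √5) * a ^ 2
          = LatticeKink.lam₀ + LatticeKink.slope * (a ^ 2 / 12) := by
        rw [LatticeKink.lam₀, LatticeKink.slope]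
        field_simp
        ring
      rw [e1]
      refine hbound.trans (le_of_eq ?_)
      ring
  · refine hmono (hin a ha).1 (hin b hb).1 ?_
    have := ha.1
    gcongr
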